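/- \textbf{Theorem (Stochastic realization of GBSs: existence).} \emph{Setting.} Let $(\Omega,\mathcal F,P)$ be a probability space; random variables that agree almost surely are identified. Let $\Sigma$ be a finite alphabet, $\Sigma^*$ the set of all words over $\Sigma$, $\Sigma^+$ the set of non-empty words, $\{p_\sigma>0\}_{\sigma\in\Sigma}$ fixed real numbers, and $p_w=p_{\sigma_1}\cdots p_{\sigma_k}$ for $w=\sigma_1\cdots\sigma_k$. Let $\{\mathbf u_\sigma(t)\}_{\sigma\in\Sigma}$, $t\in\mathbb Z$, be real-valued input processes, and for $w=\sigma_1\cdots\sigma_k\in\Sigma^+$ put $\mathbf u_w(t)=\mathbf u_{\sigma_1}(t-k+1)\,\mathbf u_{\sigma_2}(t-k+2)\cdots\mathbf u_{\sigma_k}(t)$. Assume that $\sum_\sigma\alpha_\sigma\mathbf u_\sigma(t)=1$ for all $t$, for some real numbers $\alpha_\sigma$, and that $E[\mathbf u_w(t)^2]<\infty$ for all $w\in\Sigma^+$ and $t\in\mathbb Z$. Let $L\subseteq\Sigma^+$ be a set of admissible words: $\Sigma\subseteq L$; $\mathbf u_w(t)=0$ almost surely for all $t$ and all $w\in\Sigma^+\setminus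 L$; and there is $S\subseteq\Sigma\times\Sigma$ such that a word $\sigma_1\cdots\sigma_k$ with $k>1$ belongs to $L$ if and only if $(\sigma_i,\sigma_{i+1})\in S$ for all $1\le i<k$. For an $\mathbb R^k$-valued process $\mathbf r$ and $w\in\Sigma^+$ let $\mathbf z^{\mathbf r}_w(t)=\frac1{\sqrt{p_w}}\mathbf r(t-|w|)\,\mathbf u_w(t-1)$, let $T^{\mathbf r}_{w,v}=E[\mathbf z^{\mathbf r}_w(t)\mathbf z^{\mathbf r}_v(t)^T]$ and $\Lambda^{\mathbf r}_w=E[\mathbf r(t)\mathbf z^{\mathbf r}_w(t)^T]$, and let $H^{\mathbf r}_t$ be the closed subspace of the space of square-integrable real random variables generated by the entries of $\mathbf z^{\mathbf r}_w(t)$, $w\in\Sigma^+$. \emph{RC processes.} $\mathbf r$ is an RC process if for all $w,v\in\Sigma^+$ and $\sigma,\sigma'\in\Sigma$: (1) $\mathbf r(t)$ and $\mathbf z^{\mathbf r}_w(t)$ are square integrable with zero mean, and $\Lambda^{\mathbf r}_w$, $T^{\mathbf r}_{w,v}$ do not depend on $t$; (2) $T^{\mathbf r}_{\sigma,\sigma'}=0$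 if $\sigma\neq\sigma'$; $T^{\mathbf r}_{w\sigma,v\sigma'}=0$ and $T^{\mathbf r}_{w\sigma,\sigma'}=0$ if $\sigma\ne\sigma'$; $T^{\mathbf r}_{w\sigma,v\sigma}=T^{\mathbf r}_{w,v}$ if $w\sigma\in L$ or $v\sigma\in L$; $T^{\mathbf r}_{w\sigma,\sigma}=(\Lambda^{\mathbf r}_w)^T$ if $w\sigma\in L$; (3) $T^{\mathbf r}_{w,v}=0$ if $w\notin L$ or $v\notin L$; and $T^{\mathbf r}_{v,w}=0$ whenever exactly one of $w\sigma$, $v\sigma$ belongs to $L$. \emph{GBSs.} A generalized bilinear system (GBS) is a system $$\mathbf x(t+1)=\sum_{\sigma\in\Sigma}\bigl(A_\sigma\mathbf x(t)+K_\sigma\mathbf v(t)\bigr)\mathbf u_\sigma(t),\qquad \mathbf y(t)=C\mathbf x(t)+D\mathbf v(t),\qquad t\in\mathbb Z,$$ with real matrices $A_\sigma\in\mathbb R^{n\times n}$, $K_\sigma\in\mathbb R^{n\times m}$, $C\in\mathbb R^{p\times n}$, $D\in\mathbb R^{p\times m}$, an $\mathbb R^n$-valued state process $\mathbf x$ and an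 $\mathbb R^m$-valued noise process $\mathbf v$ on $\Omega$; it is a realization of its output process $\mathbf y$. It is called \emph{regular} if (i) $\mathbf v$ is RC; (ii) $T^{\mathbf v}_{w,v}=0$ for all $w\ne v$ in $\Sigma^+$; (iii) the entries of $\mathbf x(t)$ belong to $H^{\mathbf v}_t$ for all $t$; (iv) all eigenvalues of $\sum_\sigma p_\sigma A_\sigma^T\otimes A_\sigma^T$ lie in the open unit disk; (v) $A_{\sigma_2}A_{\sigma_1}=0$ and $A_{\sigma_2}K_{\sigma_1}T^{\mathbf v}_{\sigma_1,\sigma_1}=0$ whenever $\sigma_1\sigma_2\notin L$. It is \emph{in forward innovation form} if it is regular, $D=I_p$, and $\mathbf v(t)=\mathbf e(t)$ for all $t$, where $\mathbf e(t)$ is $\mathbf y(t)$ minus the (entrywise) orthogonal projection of $\mathbf y(t)$ onto $H^{\mathbf y}_t$. \emph{Covariance family.} For an $\mathbb R^p$-valued RC process $\mathbf y$, let $\Psi_{\mathbf y}=\{S_{(j,\sigma)}\mid 1\le j\le p,\ \sigma\in\Sigma\}$, where $S_{(j,\sigma)}:\Sigma^*\to\mathbb R^p$ maps $w$ to the $j$-th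 column of $\Lambda^{\mathbf y}_{\sigma w}$. The family is \emph{rational} if for some $n$ there are matrices $C\in\mathbb R^{p\times n}$, $A_\sigma\in\mathbb R^{n\times n}$ and vectors $B_{(j,\sigma)}\in\mathbb R^n$ with $S_{(j,\sigma)}(\sigma_1\cdots\sigma_k)=CA_{\sigma_k}\cdots A_{\sigma_1}B_{(j,\sigma)}$ for all $k\ge0$ and $\sigma_1,\dots,\sigma_k\in\Sigma$. It is \emph{square summable} if $\sum_{w\in\Sigma^*}\|S_{(j,\sigma)}(w)\|_2^2<\infty$ for all $(j,\sigma)$. \emph{Claim.} Let $\mathbf y$ be an $\mathbb R^p$-valued process such that $\frac1{\sqrt{p_w}}\mathbf y(t+|w|)\,\mathbf u_w(t+|w|-1)$ is square integrable for all $w\in\Sigma^+$ and $t\in\mathbb Z$. Then $\mathbf y$ has a realization by a regular GBS if and only if $\mathbf y$ is an RC process and $\Psi_{\mathbf y}$ is rational and square summable. Moreover, if $\mathbf y$ has a realization by a regular GBS, then it has a realization by a GBS in forward innovation form. -/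

import Mathlib

open MeasureTheory Filter Topology Matrix
open scoped Kronecker ENNReal

noncomputable section

namespace GBSReal

/-! ### Words and formal power series

Words over the alphabet `ι` are lists; the word `σ₁ σ₂ ⋯ σₖ` is `[σ₁, σ₂, …, σₖ]`, and `[]` is the
empty word. -/

/-- `A_w = A_{σₖ} ⋯ A_{σ₁}` for `w = σ₁ ⋯ σₖ`, and the identity for the empty word. -/
def wordProd {ι : Type*} {n : ℕ} (A : ι → Matrix (Fin n) (Fin n) ℝ) :
    List ι → Matrix (Fin n) (Fin n) ℝ
  | [] => 1
  | σ :: w => wordProd A w * A σ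

/-- A family (indexed by `J`) of formal power series `S j : ι* → ℝ^p` is rational if
`S j w = C A_w B_j` for some finite-dimensional representation. -/
def IsRational {ι J : Type*} {p : ℕ} (S : J → List ι → (Fin p → ℝ)) : Prop :=
  ∃ (n : ℕ) (C : Matrix (Fin p) (Fin n) ℝ) (A : ι → Matrix (Fin n) (Fin n) ℝ)
    (B : J → (Fin n → ℝ)),
    ∀ (j : J) (w : List ι), S j w = C *ᵥ (wordProd A w *ᵥ B j)

/-- A formal power series is square summable if the partial sums
`∑_{k ≤ N} ∑_{|w| = k} ‖S w‖₂²` converge to a finite limit (Euclidean norm). -/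
def IsSquareSummableSeries {ι : Type*} [Fintype ι] {p : ℕ} (S : List ι → (Fin p → ℝ)) : Prop :=
  ∃ l : ℝ, Tendsto
    (fun N : ℕ => ∑ k ∈ Finset.range (N + 1), ∑ w : Fin k → ι,
      ‖(WithLp.toLp 2 (S (List.ofFn w)) : EuclideanSpace ℝ (Fin p))‖ ^ 2)
    atTop (𝓝 l)

/-- A family of formal power series is square summable if each member is. -/
def IsSquareSummable {ι J : Type*} [Fintype ι] {p : ℕ} (S : J → List ι → (Fin p → ℝ)) : Prop :=
  ∀ j, IsSquareSummableSeries (S j)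

/-- All (complex) eigenvalues lie in the open unit disk. -/
def IsStableMatrix {κ : Type*} [Fintype κ] [DecidableEq κ] (M : Matrix κ κ ℝ) : Prop :=
  ∀ μ ∈ spectrum ℂ (M.map (fun x : ℝ => (x : ℂ))), ‖μ‖ < 1

/-! ### Products of inputs, and the processes `z_w` -/

section Processes

variable {Ω ι : Type*}

/-- `p_w`, the product of the weights of the letters of `w`. -/
def wordWeight (wt : ι → ℝ) (w : List ι) : ℝ := (w.map wt).prod

/-- `u_w(t) = u_{σ₁}(t-k+1) u_{σ₂}(t-k+2) ⋯ u_{σₖ}(t)` for `w = σ₁ ⋯ σₖ`. -/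
def uWord (u : ι → ℤ → Ω → ℝ) : List ι → ℤ → Ω → ℝ
  | [], _, _ => 1
  | σ :: w, t, ω => u σ (t - (w.length : ℤ)) ω * uWord u w t ω

/-- `z^r_w(t) = r(t-|w|) u_w(t-1) / √p_w`. -/
def zPast (wt : ι → ℝ) (u : ι → ℤ → Ω → ℝ) {k : ℕ} (r : ℤ → Ω → (Fin k → ℝ))
    (w : List ι) (t : ℤ) (ω : Ω) : Fin k → ℝ :=
  (uWord u w (t - 1) ω * (1 / √(wordWeight wt w))) • r (t - (w.length : ℤ)) ω

/-- `z^f_w(t) = y(t+|w|) u_w(t+|w|-1) / √p_w`. -/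
def zFuture (wt : ι → ℝ) (u : ι → ℤ → Ω → ℝ) {k : ℕ} (y : ℤ → Ω → (Fin k → ℝ))
    (w : List ι) (t : ℤ) (ω : Ω) : Fin k → ℝ :=
  (uWord u w (t + (w.length : ℤ) - 1) ω * (1 / √(wordWeight wt w))) • y (t + (w.length : ℤ)) ω

variable [MeasurableSpace Ω] (P : Measure Ω)

/-- A vector-valued random variable is mean-square integrable if its coordinates are. -/
def SqIntegrable {k : ℕ} (X : Ω → (Fin k → ℝ)) : Prop :=
  ∀ i, MemLp (fun ω => X ω i) 2 P

/-- The matrix `E[X Yᵀ]`. -/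
def crossCov {k l : ℕ} (X : Ω → (Fin k → ℝ)) (Y : Ω → (Fin l → ℝ)) : Matrix (Fin k) (Fin l) ℝ :=
  Matrix.of fun i j => ∫ ω, X ω i * Y ω j ∂P

/-- `T^r_{w,v} = E[z^r_w(t) z^r_v(t)ᵀ]`, evaluated at time `t`. -/
def covT (wt : ι → ℝ) (u : ι → ℤ → Ω → ℝ) {k : ℕ} (r : ℤ → Ω → (Fin k → ℝ))
    (w v : List ι) (t : ℤ) : Matrix (Fin k) (Fin k) ℝ :=
  crossCov P (zPast wt u r w t) (zPast wt u r v t)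

/-- `Λ^r_w = E[r(t) z^r_w(t)ᵀ]`, evaluated at time `t`. -/
def covLam (wt : ι → ℝ) (u : ι → ℤ → Ω → ℝ) {k : ℕ} (r : ℤ → Ω → (Fin k → ℝ))
    (w : List ι) (t : ℤ) : Matrix (Fin k) (Fin k) ℝ :=
  crossCov P (r t) (zPast wt u r w t)

/-- The standing assumption on the input process: some fixed linear combination of the inputs is
`1`, and all first and second moments of the products `u_w(t)` are finite. -/
structure InputAssumption [Fintype ι] (u : ι → ℤ → Ω → ℝ) : Prop where
  exists_comb : ∃ α : ι → ℝ, ∀ t, ∀ᵐ ω ∂P, ∑ σ, α σ * u σ t ω = 1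
  moments : ∀ w : List ι, w ≠ [] → ∀ t, MemLp (uWord u w t) 2 P

/-- Sets of admissible words. -/
structure IsAdmissible (u : ι → ℤ → Ω → ℝ) (L : Set (List ι)) : Prop where
  nonempty_word : ∀ w ∈ L, w ≠ []
  letter_mem : ∀ σ, [σ] ∈ L
  zero_of_not_mem : ∀ w : List ι, w ≠ [] → w ∉ L → ∀ t, uWord u w t =ᵐ[P] 0
  exists_pairs : ∃ S : Set (ι × ι), ∀ w : List ι, 1 < w.length →
    (w ∈ L ↔ w.IsChain (fun σ σ' => (σ, σ') ∈ S))

/-- The recursive covariance (RC) property. -/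
structure IsRC (wt : ι → ℝ) (u : ι → ℤ → Ω → ℝ) (L : Set (List ι)) {k : ℕ}
    (r : ℤ → Ω → (Fin k → ℝ)) : Prop where
  sqInt : ∀ t, SqIntegrable P (r t)
  sqInt_z : ∀ w, w ≠ [] → ∀ t, SqIntegrable P (zPast wt u r w t)
  mean_zero : ∀ t i, ∫ ω, r t ω i ∂P = 0
  mean_zero_z : ∀ w, w ≠ [] → ∀ t i, ∫ ω, zPast wt u r w t ω i ∂P = 0
  stat_lam : ∀ w, w ≠ [] → ∀ t s, covLam P wt u r w (t + s) = covLam P wt u r w t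
  stat_T : ∀ w v, w ≠ [] → v ≠ [] → ∀ t s, covT P wt u r w v (t + s) = covT P wt u r w v t
  T_letters : ∀ σ σ', σ ≠ σ' → ∀ t, covT P wt u r [σ] [σ'] t = 0
  T_eq : ∀ w v, w ≠ [] → v ≠ [] → ∀ σ, (w ++ [σ] ∈ L ∨ v ++ [σ] ∈ L) →
    ∀ t, covT P wt u r (w ++ [σ]) (v ++ [σ]) t = covT P wt u r w v t
  T_ne : ∀ w v, w ≠ [] → v ≠ [] → ∀ σ σ', σ ≠ σ' →
    ∀ t, covT P wt u r (w ++ [σ]) (v ++ [σ']) t = 0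
  T_letter_eq : ∀ w, w ≠ [] → ∀ σ, w ++ [σ] ∈ L →
    ∀ t, covT P wt u r (w ++ [σ]) [σ] t = (covLam P wt u r w t)ᵀ
  T_letter_ne : ∀ w, w ≠ [] → ∀ σ σ', σ ≠ σ' → ∀ t, covT P wt u r (w ++ [σ]) [σ'] t = 0
  T_not_mem : ∀ w v, w ≠ [] → v ≠ [] → (w ∉ L ∨ v ∉ L) → ∀ t, covT P wt u r w v t = 0
  T_mixed : ∀ w v, w ≠ [] → v ≠ [] → ∀ σ, w ++ [σ] ∈ L → v ++ [σ] ∉ L →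
    ∀ t, covT P wt u r v w t = 0
  T_mixed' : ∀ w v, w ≠ [] → v ≠ [] → ∀ σ, v ++ [σ] ∈ L → w ++ [σ] ∉ L →
    ∀ t, covT P wt u r v w t = 0

/-- The family `Ψ_y`: `S_{(j,σ)}(w)` is the `j`-th column of `Λ^y_{σw}`. For an RC process `Λ^y`
does not depend on time, and is evaluated here at time `0`. -/
def Psi (wt : ι → ℝ) (u : ι → ℤ → Ω → ℝ) {p : ℕ} (y : ℤ → Ω → (Fin p → ℝ)) :
    Fin p × ι → List ι → (Fin p → ℝ) :=
  fun jσ w i => covLam P wt u y (jσ.2 :: w) 0 i jσ.1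

/-! ### Hilbert spaces generated by the `z_w`, and the innovation process -/

/-- `H^r_t`: the closed subspace of `L²(P)` generated by the entries of `z^r_w(t)`, over all
non-empty words `w`. -/
abbrev pastSpace (wt : ι → ℝ) (u : ι → ℤ → Ω → ℝ) {k : ℕ} (r : ℤ → Ω → (Fin k → ℝ)) (t : ℤ) :
    Submodule ℝ (Lp ℝ 2 P) :=
  (Submodule.span ℝ {f : Lp ℝ 2 P | ∃ w : List ι, w ≠ [] ∧ ∃ i : Fin k,
    (f : Ω → ℝ) =ᵐ[P] fun ω => zPast wt u r w t ω i}).topologicalClosure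

/-- All coordinates of the random vector `X` belong to the subspace `M` of `L²(P)`. -/
def BelongsTo (M : Submodule ℝ (Lp ℝ 2 P)) {k : ℕ} (X : Ω → (Fin k → ℝ)) : Prop :=
  ∀ i, ∃ f ∈ M, (f : Ω → ℝ) =ᵐ[P] fun ω => X ω i

open Classical in
/-- Coordinatewise orthogonal projection of a mean-square integrable random vector onto `M`
(set to `0` on coordinates that are not mean-square integrable). -/
def projOn (M : Submodule ℝ (Lp ℝ 2 P)) [M.HasOrthogonalProjection] {k : ℕ}
    (X : Ω → (Fin k → ℝ)) : Ω → (Fin k → ℝ) :=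
  fun ω i => if h : MemLp (fun ω' => X ω' i) 2 P then
    ((M.starProjection (h.toLp (fun ω' => X ω' i)) : Lp ℝ 2 P) : Ω → ℝ) ω else 0

/-- The forward innovation process `e(t) = y(t) - E_l[y(t) | {z^y_w(t)}]`. -/
def innovation (wt : ι → ℝ) (u : ι → ℤ → Ω → ℝ) {p : ℕ} (y : ℤ → Ω → (Fin p → ℝ)) (t : ℤ) :
    Ω → (Fin p → ℝ) :=
  fun ω => y t ω - projOn P (pastSpace P wt u y t) (y t) ω

/-! ### Generalized bilinear systems -/

/-- A generalized bilinear system with state dimension `n`, noise dimension `m` and output dimension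
`p`, driven by the inputs `u`, together with its state and noise processes. -/
structure GBS [Fintype ι] (u : ι → ℤ → Ω → ℝ) (n m p : ℕ) where
  A : ι → Matrix (Fin n) (Fin n) ℝ
  K : ι → Matrix (Fin n) (Fin m) ℝ
  C : Matrix (Fin p) (Fin n) ℝ
  D : Matrix (Fin p) (Fin m) ℝ
  x : ℤ → Ω → (Fin n → ℝ)
  v : ℤ → Ω → (Fin m → ℝ)
  measurable_x : ∀ t, Measurable (x t)
  measurable_v : ∀ t, Measurable (v t)
  state_eq : ∀ t, ∀ᵐ ω ∂P,
    x (t + 1) ω = ∑ σ, u σ t ω • (A σ *ᵥ x t ω + K σ *ᵥ v t ω)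

namespace GBS

variable {P} [Fintype ι] {u : ι → ℤ → Ω → ℝ} {n m p : ℕ}

/-- The output process `C x(t) + D v(t)`. -/
def output (B : GBS P u n m p) (t : ℤ) (ω : Ω) : Fin p → ℝ :=
  B.C *ᵥ B.x t ω + B.D *ᵥ B.v t ω

/-- The system is a realization of `y` if its output coincides with `y` (almost surely, at every
time). -/
def IsRealization (B : GBS P u n m p) (y : ℤ → Ω → (Fin p → ℝ)) : Prop :=
  ∀ t, y t =ᵐ[P] B.output t

/-- The standing assumptions on generalized bilinear systems. -/
structure Regular (wt : ι → ℝ) (L : Set (List ι)) (B : GBS P u n m p) : Prop where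
  noise_rc : IsRC P wt u L B.v
  noise_orth : ∀ w w' : List ι, w ≠ [] → w' ≠ [] → w ≠ w' → ∀ t, covT P wt u B.v w w' t = 0
  state_mem : ∀ t, BelongsTo P (pastSpace P wt u B.v t) (B.x t)
  stable : IsStableMatrix (∑ σ, wt σ • ((B.A σ)ᵀ ⊗ₖ (B.A σ)ᵀ))
  not_mem : ∀ σ₁ σ₂, [σ₁, σ₂] ∉ L →
    B.A σ₂ * B.A σ₁ = 0 ∧ ∀ t, B.A σ₂ * B.K σ₁ * covT P wt u B.v [σ₁] [σ₁] t = 0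

/-- The system is a realization of `y` in forward innovation form: it realizes `y`, it satisfies
the standing assumptions, `D = I`, and the noise is the forward innovation process of `y`. -/
structure IsForwardInnovationRealization (wt : ι → ℝ) (L : Set (List ι)) (B : GBS P u n p p)
    (y : ℤ → Ω → (Fin p → ℝ)) : Prop where
  realizes : B.IsRealization y
  regular : B.Regular wt L
  D_eq : B.D = 1
  noise_eq : ∀ t, B.v t =ᵐ[P] innovation P wt u y t

end GBS

end Processes

end GBSReal

end

/-! Everything takes place in L² at time 0. Let r be an RC process. Since its Gram matrices do not
depend on t, z_w(0) ↦ z_w(t) extends to an isometry of the past, the time shift. Since T_{wσ,vσ} =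
T_{w,v} when one of the two words is admissible, and z_{wσ} = 0 when wσ ∉ L, also z_w(0) ↦ z_{wσ}(0)
extends to a contraction, multiplication by σ (`IsRC.nonempty_pastModel`). Multiplications by
different letters have orthogonal ranges. Pathwise, the one-step rule is a product with u_σ(t)/√p_σ
(`coeFn_shift_mul`). Any process s(t) = shift_t f + D r(t), with f in the past, then inherits the RC
property (`IsTransform.isRC`). This is applied twice: to y over the noise v, and to the innovation e
over y.

From a system to the covariances: whiteness of v forces x(t) = shift_t f with a fixed f
(`exists_state`). So y is a transform of v, hence RC. Pairing the state equation with a vector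
multiplied by τ gives ⟨f, τ·g⟩ = √p_τ A_τ ⟨f, g⟩. The noise is orthogonal to its past, so Λ^y_{σw}
is C times a product of the scaled matrices times a fixed vector. Stability of Σ p_σ A_σᵀ ⊗ A_σᵀ
makes these products square summable.

From the covariances to a system: take a minimal representation (C, A, B) of Ψ_y. By observability
every coordinate of the state is a combination of projections of future outputs onto the past
(`exists_predictorState`); the resulting f satisfies ⟨f, z_{σw}⟩ = A_w B_σ, and C f is the
projection of y(0). Hence e = y − C f is orthogonal to the past and white. The state equation holds
with K_σ given by projecting f onto the entries of z^e_σ (`exists_gain`). Iterating it N times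
leaves a remainder bounded by Σ_{|w|=N} ‖A_w‖², which tends to 0, so the state lies in the past of
e. Minimality transfers square summability of Ψ_y to all entries of A_w, which yields stability, and
turns Λ_w = 0 for w ∉ L into the vanishing of products along inadmissible pairs. -/

noncomputable section

namespace GBSReal

/-! ### Sums over words of a given length -/

section Words

variable {ι : Type*} [Fintype ι] {V : Type*}

/-- The sum of `φ w` over all words `w` of length `k`. -/
def wordSum [AddCommMonoid V] (k : ℕ) (φ : List ι → V) : V := ∑ w : Fin k → ι, φ (List.ofFn w)

theorem wordSum_zero [AddCommMonoid V] (φ : List ι → V) : wordSum 0 φ = φ [] := by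
  simp [wordSum]

theorem wordSum_succ_cons [AddCommMonoid V] (k : ℕ) (φ : List ι → V) :
    wordSum (k + 1) φ = ∑ σ, wordSum k fun w => φ (σ :: w) := by
  unfold wordSum
  rw [← Fintype.sum_prod_type' (f := fun σ w => φ (σ :: List.ofFn w))]
  refine (Fintype.sum_equiv (Fin.consEquiv fun _ => ι) _ _ fun x => ?_).symm
  simp [Fin.consEquiv, List.ofFn_succ]

theorem wordSum_succ_snoc [AddCommMonoid V] (k : ℕ) (φ : List ι → V) :
    wordSum (k + 1) φ = ∑ σ, wordSum k fun w => φ (w ++ [σ]) := by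
  unfold wordSum
  rw [← Fintype.sum_prod_type' (f := fun σ w => φ (List.ofFn w ++ [σ]))]
  refine (Fintype.sum_equiv (Fin.snocEquiv fun _ => ι) _ _ fun x => ?_).symm
  rw [List.ofFn_succ_last]
  simp [Fin.snocEquiv]

theorem wordSum_mono (k : ℕ) {φ ψ : List ι → ℝ} (h : ∀ w, φ w ≤ ψ w) :
    wordSum k φ ≤ wordSum k ψ :=
  Finset.sum_le_sum fun _ _ => h _

theorem wordSum_nonneg (k : ℕ) {φ : List ι → ℝ} (h : ∀ w, 0 ≤ φ w) : 0 ≤ wordSum k φ :=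
  Finset.sum_nonneg fun _ _ => h _

theorem wordSum_mul_left (k : ℕ) (c : ℝ) (φ : List ι → ℝ) :
    wordSum k (fun w => c * φ w) = c * wordSum k φ :=
  (Finset.mul_sum _ _ _).symm

theorem wordSum_sum {κ : Type*} [Fintype κ] [AddCommMonoid V] (k : ℕ) (φ : κ → List ι → V) :
    wordSum k (fun w => ∑ i, φ i w) = ∑ i, wordSum k (φ i) :=
  Finset.sum_comm

/-- A nonnegative function on words is summable as soon as the sums over the words of length `k`
are summable in `k`. -/
theorem summable_words_iff {φ : List ι → ℝ} (h : ∀ w, 0 ≤ φ w) :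
    Summable φ ↔ Summable fun k => wordSum k φ := by
  rw [← (List.equivSigmaTuple (α := ι)).symm.summable_iff,
    summable_sigma_of_nonneg (f := φ ∘ List.equivSigmaTuple.symm) fun x => h _]
  simp only [tsum_fintype]
  refine ⟨fun h => h.2, fun h => ⟨fun k => (hasSum_fintype _).summable, h⟩⟩

theorem isSquareSummableSeries_iff {p : ℕ} (S : List ι → Fin p → ℝ) :
    IsSquareSummableSeries S ↔
      Summable fun k => wordSum k fun w => ∑ i, S w i ^ 2 := by
  have key : ∀ N : ℕ, (∑ k ∈ Finset.range (N + 1), ∑ w : Fin k → ι,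
      ‖(WithLp.toLp 2 (S (List.ofFn w)) : EuclideanSpace ℝ (Fin p))‖ ^ 2) =
      ∑ k ∈ Finset.range (N + 1), wordSum k fun w => ∑ i, S w i ^ 2 := by
    intro N
    simp [wordSum, EuclideanSpace.norm_sq_eq]
  have h0 : ∀ k, 0 ≤ wordSum k fun w => ∑ i, S w i ^ 2 :=
    fun k => wordSum_nonneg k fun w => Finset.sum_nonneg fun i _ => sq_nonneg _
  unfold IsSquareSummableSeries
  simp only [key]
  constructor
  · rintro ⟨l, hl⟩
    exact ((hasSum_iff_tendsto_nat_of_nonneg h0 l).2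
      ((tendsto_add_atTop_iff_nat (f := fun N => ∑ k ∈ Finset.range N, wordSum k fun w =>
        ∑ i, S w i ^ 2) 1).1 hl)).summable
  · rintro ⟨l, hl⟩
    exact ⟨l, (tendsto_add_atTop_iff_nat (f := fun N => ∑ k ∈ Finset.range N, wordSum k fun w =>
        ∑ i, S w i ^ 2) 1).2 hl.tendsto_sum_nat⟩

end Words

/-! ### Products of matrices along words, and stability -/

section Matrices

variable {ι : Type*} {n : ℕ}

theorem wordProd_append (A : ι → Matrix (Fin n) (Fin n) ℝ) (w v : List ι) :
    wordProd A (w ++ v) = wordProd A v * wordProd A w := by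
  induction w with
  | nil => simp [wordProd]
  | cons σ w ih => simp [wordProd, ih, mul_assoc]

theorem wordProd_snoc (A : ι → Matrix (Fin n) (Fin n) ℝ) (w : List ι) (σ : ι) :
    wordProd A (w ++ [σ]) = A σ * wordProd A w := by
  simp [wordProd_append, wordProd]

variable [Fintype ι]

/-- The mixed-product rule multiplies one letter at a time; transposition reverses products, which
matches the order of factors in `wordProd`. -/
theorem kronecker_sum_pow (A : ι → Matrix (Fin n) (Fin n) ℝ) (k : ℕ) :
    (∑ σ, (A σ)ᵀ ⊗ₖ (A σ)ᵀ) ^ k = wordSum k fun w => (wordProd A w)ᵀ ⊗ₖ (wordProd A w)ᵀ := by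
  induction k with
  | zero => simp [wordSum_zero, wordProd]
  | succ k ih =>
    rw [pow_succ', ih, wordSum_succ_cons, Finset.sum_mul]
    refine Finset.sum_congr rfl fun σ _ => ?_
    simp only [wordSum, Finset.mul_sum, wordProd, transpose_mul, mul_kronecker_mul]

theorem kronecker_sum_pow_apply (A : ι → Matrix (Fin n) (Fin n) ℝ) (k : ℕ) (i j i' j' : Fin n) :
    ((∑ σ, (A σ)ᵀ ⊗ₖ (A σ)ᵀ) ^ k) (i, i') (j, j') =
      wordSum k fun w => wordProd A w j i * wordProd A w j' i' := by
  rw [kronecker_sum_pow]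
  simp [wordSum, Matrix.sum_apply, kroneckerMap_apply]

attribute [local instance] Matrix.linftyOpNormedRing Matrix.linftyOpNormedAlgebra

/-- Gelfand's formula and the root test: eventually ‖aᵏ‖ ≤ rᵏ for some r strictly between the
spectral radius and 1. -/
theorem summable_pow_of_spectralRadius_lt_one {𝔸 : Type*} [NormedRing 𝔸] [NormedAlgebra ℂ 𝔸]
    [CompleteSpace 𝔸] {a : 𝔸} (ha : spectralRadius ℂ a < 1) : Summable fun k : ℕ => ‖a ^ k‖ := by
  obtain ⟨r, hr, hr1⟩ := ENNReal.lt_iff_exists_nnreal_btwn.1 ha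
  have hr1' : r < 1 := by exact_mod_cast hr1
  have h := (spectrum.pow_nnnorm_pow_one_div_tendsto_nhds_spectralRadius a).eventually
    (eventually_lt_nhds hr)
  refine Summable.of_norm_bounded_eventually_nat (g := fun k : ℕ => (r : ℝ) ^ k)
    (summable_geometric_of_lt_one r.2 (by exact_mod_cast hr1')) ?_
  filter_upwards [h, eventually_gt_atTop 0] with k hk hk0
  have hk' : (‖a ^ k‖₊ : ℝ≥0∞) ≤ (r : ℝ≥0∞) ^ k := by
    have := ENNReal.rpow_le_rpow hk.le (z := k) (by positivity)
    rwa [← ENNReal.rpow_mul, one_div, inv_mul_cancel₀ (by positivity), ENNReal.rpow_one,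
      ENNReal.rpow_natCast] at this
  have hk'' : ‖a ^ k‖₊ ≤ r ^ k := by exact_mod_cast hk'
  rw [norm_norm]
  exact_mod_cast hk''

theorem IsStableMatrix.summable_pow_apply {κ : Type*} [Fintype κ] [DecidableEq κ]
    {M : Matrix κ κ ℝ} (hM : IsStableMatrix M) (i j : κ) : Summable fun k : ℕ => (M ^ k) i j := by
  have : Nonempty κ := ⟨i⟩
  have h1 : spectralRadius ℂ (M.map (fun x : ℝ => (x : ℂ))) < ((1 : NNReal) : ℝ≥0∞) :=
    spectrum.spectralRadius_lt_of_forall_lt _ fun μ hμ => by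
      have := hM μ hμ
      rw [← NNReal.coe_lt_coe]; simpa using this
  refine Summable.of_norm_bounded (summable_pow_of_spectralRadius_lt_one (by simpa using h1))
    fun k => ?_
  have h2 : (M.map (fun x : ℝ => (x : ℂ))) ^ k = (M ^ k).map (fun x : ℝ => (x : ℂ)) :=
    (map_pow (Complex.ofRealHom.mapMatrix) M k).symm
  rw [h2]
  have h3 : ‖(((M ^ k) i j : ℝ) : ℂ)‖ ≤ ‖(M ^ k).map (fun x : ℝ => (x : ℂ))‖ := by
    rw [Matrix.linfty_opNorm_def]
    refine le_trans ?_ (NNReal.coe_le_coe.2 (Finset.le_sup (f := fun i => ∑ j,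
      ‖(M ^ k).map (fun x : ℝ => (x : ℂ)) i j‖₊) (Finset.mem_univ i)))
    rw [NNReal.coe_sum]
    exact Finset.single_le_sum (f := fun j => ((‖(M ^ k).map (fun x : ℝ => (x : ℂ)) i j‖₊ : NNReal) : ℝ))
      (fun _ _ => NNReal.coe_nonneg _) (Finset.mem_univ j)
  simpa using h3

/-- A complex eigenvector v for μ gives Mᵏ v = μᵏ v; comparing a nonzero coordinate forces μᵏ → 0.
-/
theorem isStableMatrix_of_tendsto {κ : Type*} [Fintype κ] [DecidableEq κ]
    {M : Matrix κ κ ℝ} (hM : ∀ i j, Tendsto (fun k : ℕ => (M ^ k) i j) atTop (𝓝 0)) :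
    IsStableMatrix M := by
  intro μ hμ
  rw [← Matrix.spectrum_toLin', ← Module.End.hasEigenvalue_iff_mem_spectrum] at hμ
  obtain ⟨v, hv⟩ := hμ.exists_hasEigenvector
  have hpow : ∀ k : ℕ, ((M.map (fun x : ℝ => (x : ℂ))) ^ k) *ᵥ v = μ ^ k • v := by
    intro k
    have := hv.pow_apply k
    rwa [← Matrix.toLin'_pow, Matrix.toLin'_apply] at this
  obtain ⟨i, hi⟩ : ∃ i, v i ≠ 0 := by
    by_contra! h
    exact hv.2 (funext h)
  have h2 : ∀ k : ℕ, (M.map (fun x : ℝ => (x : ℂ))) ^ k = (M ^ k).map (fun x : ℝ => (x : ℂ)) :=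
    fun k => (map_pow (Complex.ofRealHom.mapMatrix) M k).symm
  have h3 : Tendsto (fun k : ℕ => μ ^ k * v i) atTop (𝓝 0) := by
    have : ∀ k : ℕ, μ ^ k * v i = ∑ j, (((M ^ k) i j : ℝ) : ℂ) * v j := by
      intro k
      have := congrFun (hpow k) i
      rw [h2] at this
      simpa [Matrix.mulVec, dotProduct] using this.symm
    simp only [this]
    rw [show (0 : ℂ) = ∑ j, ((0 : ℝ) : ℂ) * v j by simp]
    refine tendsto_finsetSum _ fun j _ => Tendsto.mul_const _ ?_
    exact (Complex.continuous_ofReal.tendsto 0).comp (hM i j)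
  have h4 : Tendsto (fun k : ℕ => μ ^ k) atTop (𝓝 0) := by
    have := h3.mul_const (v i)⁻¹
    simpa [mul_assoc, hi] using this
  exact tendsto_pow_atTop_nhds_zero_iff_norm_lt_one.1 h4

/-- The entries of the Kronecker power at pairs of equal indices are exactly the sums of squares. -/
theorem IsStableMatrix.summable_wordSum_sq {A : ι → Matrix (Fin n) (Fin n) ℝ}
    (hA : IsStableMatrix (∑ σ, (A σ)ᵀ ⊗ₖ (A σ)ᵀ)) (i j : Fin n) :
    Summable fun k => wordSum k fun w => wordProd A w i j ^ 2 := by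
  simpa only [kronecker_sum_pow_apply, sq] using hA.summable_pow_apply (j, j) (i, i)

/-- A general entry of the Kronecker power is a sum of products of two entries of A_w, and |ab| ≤ a²
+ b² bounds it by two sums of squares. -/
theorem isStableMatrix_of_summable_sq {A : ι → Matrix (Fin n) (Fin n) ℝ}
    (hA : ∀ i j, Summable fun w => wordProd A w i j ^ 2) :
    IsStableMatrix (∑ σ, (A σ)ᵀ ⊗ₖ (A σ)ᵀ) := by
  refine isStableMatrix_of_tendsto ?_
  rintro ⟨i, i'⟩ ⟨j, j'⟩
  have h : ∀ i j, Tendsto (fun k => wordSum k fun w => wordProd A w i j ^ 2) atTop (𝓝 0) :=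
    fun i j => ((summable_words_iff fun w => sq_nonneg _).1 (hA i j)).tendsto_atTop_zero
  refine squeeze_zero_norm (fun k => ?_) (by simpa using (h j i).add (h j' i'))
  rw [kronecker_sum_pow_apply]
  refine (Finset.abs_sum_le_sum_abs _ _).trans ?_
  rw [wordSum, wordSum, ← Finset.sum_add_distrib]
  refine Finset.sum_le_sum fun w _ => ?_
  rw [abs_mul]
  nlinarith [sq_nonneg (|wordProd A (List.ofFn w) j i| - |wordProd A (List.ofFn w) j' i'|),
    sq_abs (wordProd A (List.ofFn w) j i), sq_abs (wordProd A (List.ofFn w) j' i'),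
    sq_nonneg (wordProd A (List.ofFn w) j i), sq_nonneg (wordProd A (List.ofFn w) j' i')]

/-- The power series of a stable representation are square summable. -/
theorem IsStableMatrix.isSquareSummableSeries {p : ℕ} {A : ι → Matrix (Fin n) (Fin n) ℝ}
    (hA : IsStableMatrix (∑ σ, (A σ)ᵀ ⊗ₖ (A σ)ᵀ)) (C : Matrix (Fin p) (Fin n) ℝ) (b : Fin n → ℝ) :
    IsSquareSummableSeries fun w => C *ᵥ (wordProd A w *ᵥ b) := by
  rw [isSquareSummableSeries_iff]
  have hs : Summable fun k => ∑ i, ∑ x : Fin n × Fin n, ∑ y : Fin n × Fin n,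
      (C i x.1 * b x.2) ^ 2 * wordSum k (fun w => wordProd A w y.1 y.2 ^ 2) :=
    summable_sum fun i _ => summable_sum fun x _ => summable_sum fun y _ =>
      (hA.summable_wordSum_sq y.1 y.2).mul_left _
  refine Summable.of_nonneg_of_le (fun k => wordSum_nonneg k fun w =>
    Finset.sum_nonneg fun i _ => sq_nonneg _) (fun k => ?_) hs
  simp only [← wordSum_mul_left, ← wordSum_sum]
  refine wordSum_mono k fun w => Finset.sum_le_sum fun i _ => ?_
  have : (C *ᵥ (wordProd A w *ᵥ b)) i =
      ∑ x : Fin n × Fin n, (C i x.1 * b x.2) * wordProd A w x.1 x.2 := by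
    simp only [mulVec, dotProduct, Finset.mul_sum, Fintype.sum_prod_type]
    refine Finset.sum_congr rfl fun x _ => Finset.sum_congr rfl fun y _ => by ring
  -- Cauchy–Schwarz over pairs of indices produces the constants (C_{ix} b_y)².
  rw [this, ← Finset.sum_mul_sum]
  exact Finset.sum_mul_sq_le_sq_mul_sq _ _ _

end Matrices

/-! ### Minimal representations of rational families -/

section Minimal

variable {ι J : Type*} {p n : ℕ}

/-- A representation is minimal if its state space is spanned by the reachable states and no
nonzero state is unobservable. -/
structure IsMinimalRepresentation (S : J → List ι → (Fin p → ℝ)) (C : Matrix (Fin p) (Fin n) ℝ)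
    (A : ι → Matrix (Fin n) (Fin n) ℝ) (B : J → (Fin n → ℝ)) : Prop where
  apply_eq : ∀ j w, S j w = C *ᵥ (wordProd A w *ᵥ B j)
  reachable : Submodule.span ℝ (Set.range fun x : J × List ι => wordProd A x.2 *ᵥ B x.1) = ⊤
  observable : ∀ x, (∀ w, C *ᵥ (wordProd A w *ᵥ x) = 0) → x = 0

/-- The canonical state space is the span V of all shifts of the series S_j. It is
finite-dimensional because it lies in the range of the observability map of the given
representation. There A_σ is the shift by σ and C is evaluation at the empty word, so a state is the
list of its own outputs (observability), and the shifts span V by construction (reachability). -/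
theorem IsRational.exists_minimal {S : J → List ι → (Fin p → ℝ)} (hS : IsRational S) :
    ∃ (n : ℕ) (C : Matrix (Fin p) (Fin n) ℝ) (A : ι → Matrix (Fin n) (Fin n) ℝ)
      (B : J → (Fin n → ℝ)), IsMinimalRepresentation S C A B := by
  obtain ⟨n₀, C₀, A₀, B₀, h₀⟩ := hS
  set g : J × List ι → (List ι → Fin p → ℝ) := fun x v => S x.1 (x.2 ++ v) with hg
  set V : Submodule ℝ (List ι → Fin p → ℝ) := Submodule.span ℝ (Set.range g) with hV
  let obs : (Fin n₀ → ℝ) →ₗ[ℝ] (List ι → Fin p → ℝ) :=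
    LinearMap.pi fun w => C₀.mulVecLin ∘ₗ (wordProd A₀ w).mulVecLin
  have hVle : V ≤ LinearMap.range obs := by
    rw [hV, Submodule.span_le]
    rintro _ ⟨x, rfl⟩
    refine ⟨wordProd A₀ x.2 *ᵥ B₀ x.1, ?_⟩
    ext v i
    simp [obs, hg, h₀, wordProd_append]
  have : FiniteDimensional ℝ V := Submodule.finiteDimensional_of_le hVle
  let sh : ι → (List ι → Fin p → ℝ) →ₗ[ℝ] (List ι → Fin p → ℝ) :=
    fun σ => LinearMap.funLeft ℝ _ (fun w => σ :: w)
  have hsh : ∀ σ, ∀ f ∈ V, sh σ f ∈ V := by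
    intro σ f hf
    have : V ≤ V.comap (sh σ) := by
      rw [hV, Submodule.span_le]
      rintro _ ⟨x, rfl⟩
      refine Submodule.subset_span ⟨(x.1, x.2 ++ [σ]), ?_⟩
      ext v i
      simp [sh, hg, LinearMap.funLeft_apply]
    exact this hf
  let As : ι → V →ₗ[ℝ] V := fun σ => (sh σ).restrict (hsh σ)
  let Cs : V →ₗ[ℝ] (Fin p → ℝ) := LinearMap.proj [] ∘ₗ V.subtype
  let b := Module.finBasis ℝ V
  let A : ι → Matrix _ _ ℝ := fun σ => LinearMap.toMatrix b b (As σ)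
  let C := LinearMap.toMatrix b (Pi.basisFun ℝ (Fin p)) Cs
  have hmem : ∀ x, g x ∈ V := fun x => Submodule.subset_span ⟨x, rfl⟩
  let B : J → _ := fun j => ⇑(b.repr ⟨g (j, []), hmem _⟩)
  have hA : ∀ w (f : V), ∃ f' : V, (∀ v, (f' : List ι → Fin p → ℝ) v = f.1 (w ++ v)) ∧
      wordProd A w *ᵥ b.repr f = b.repr f' := by
    intro w
    induction w with
    | nil => exact fun f => ⟨f, fun v => rfl, by simp [wordProd]⟩
    | cons σ w ih =>
      intro f
      obtain ⟨f', h1, h2⟩ := ih (As σ f)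
      refine ⟨f', fun v => by rw [h1]; simp [As, sh, LinearMap.funLeft_apply], ?_⟩
      rw [wordProd, ← Matrix.mulVec_mulVec, LinearMap.toMatrix_mulVec_repr, h2]
  have hC : ∀ f : V, C *ᵥ b.repr f = f.1 [] := by
    intro f
    have := LinearMap.toMatrix_mulVec_repr b (Pi.basisFun ℝ (Fin p)) Cs f
    ext i
    rw [this]
    simp [Cs]
  have hCA : ∀ w (f : V), C *ᵥ (wordProd A w *ᵥ b.repr f) = f.1 w := by
    intro w f
    obtain ⟨f', h1, h2⟩ := hA w f
    rw [h2, hC, h1, List.append_nil]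
  refine ⟨_, C, A, B, fun j w => ?_, ?_, fun x hx => ?_⟩
  · rw [hCA]; simp [hg]
  · have hr : (fun x : J × List ι => wordProd A x.2 *ᵥ B x.1) =
        b.equivFun ∘ fun x => ⟨g x, hmem x⟩ := by
      funext x
      obtain ⟨f', h1, h2⟩ := hA x.2 ⟨g (x.1, []), hmem _⟩
      have : f' = ⟨g x, hmem x⟩ := Subtype.ext (funext fun v => by rw [h1]; simp [hg])
      change _ = b.equivFun ⟨g x, hmem x⟩
      rw [← this]
      exact h2
    rw [hr, Set.range_comp, ← LinearEquiv.coe_toLinearMap b.equivFun, Submodule.span_image]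
    have htop : Submodule.span ℝ (Set.range fun x => (⟨g x, hmem x⟩ : V)) = ⊤ := by
      have := Submodule.span_span_coe_preimage (R := ℝ) (s := Set.range g)
      rw [← this]
      congr 1
      ext ⟨f, hf⟩
      simp [Subtype.ext_iff]
    rw [htop, Submodule.map_top, LinearEquiv.range]
  · have hx' : x = b.repr (b.equivFun.symm x) := by
      have := b.equivFun.apply_symm_apply x
      exact this.symm
    have h0 : b.equivFun.symm x = 0 := by
      ext w i
      rw [← hCA, ← hx', hx]
      rfl
    rw [hx', h0]
    simp

namespace IsMinimalRepresentation

variable {S : J → List ι → (Fin p → ℝ)} {C : Matrix (Fin p) (Fin n) ℝ}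
  {A : ι → Matrix (Fin n) (Fin n) ℝ} {B : J → (Fin n → ℝ)}

/-- A matrix that contributes to no output along any reachable state is zero. -/
theorem mulVec_eq_zero (h : IsMinimalRepresentation S C A B) {M : Matrix (Fin n) (Fin n) ℝ}
    (hM : ∀ w v j, C *ᵥ (wordProd A v *ᵥ (M *ᵥ (wordProd A w *ᵥ B j))) = 0) : M = 0 := by
  have key : ⊤ ≤ LinearMap.ker M.mulVecLin := by
    rw [← h.reachable, Submodule.span_le]
    rintro _ ⟨⟨j, w⟩, rfl⟩
    exact h.observable _ fun v => hM w v j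
  ext i k
  have := key (Submodule.mem_top (x := Pi.single k 1))
  have := congrFun (LinearMap.mem_ker.1 this) i
  simpa using this

/-- Dual form of observability: the functionals x ↦ (C A_w x)_i have trivial common kernel, hence
span the dual space. -/
theorem span_rows (h : IsMinimalRepresentation S C A B) :
    Submodule.span ℝ (Set.range fun x : List ι × Fin p => (C * wordProd A x.1) x.2) = ⊤ := by
  let L : List ι × Fin p → (Fin n → ℝ) →ₗ[ℝ] ℝ :=
    fun x => LinearMap.proj x.2 ∘ₗ C.mulVecLin ∘ₗ (wordProd A x.1).mulVecLin
  have hmem : ∀ i, (LinearMap.proj i : (Fin n → ℝ) →ₗ[ℝ] ℝ) ∈ Submodule.span ℝ (Set.range L) := by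
    intro i
    refine FiniteDimensional.mem_span_of_iInf_ker_le_ker fun x hx => ?_
    have : x = 0 := h.observable x fun w => funext fun k => by
      have := (Submodule.mem_iInf _).1 hx (w, k)
      simpa [L] using this
    simp [this]
  let T : ((Fin n → ℝ) →ₗ[ℝ] ℝ) →ₗ[ℝ] (Fin n → ℝ) :=
    LinearMap.pi fun k => LinearMap.applyₗ (Pi.single k 1)
  have hT : ∀ x, T (L x) = (C * wordProd A x.1) x.2 := by
    intro x
    ext k
    simp only [T, L, LinearMap.pi_apply, LinearMap.applyₗ_apply_apply, LinearMap.comp_apply,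
      mulVecLin_apply, LinearMap.proj_apply, Matrix.mulVec_single_one]
    rfl
  rw [eq_top_iff, ← (Pi.basisFun ℝ (Fin n)).span_eq, Submodule.span_le]
  rintro _ ⟨i, rfl⟩
  have h1 : T (LinearMap.proj i) ∈ (Submodule.span ℝ (Set.range L)).map T :=
    Submodule.mem_map_of_mem (hmem i)
  rw [← Submodule.span_image, ← Set.range_comp] at h1
  have h2 : T (LinearMap.proj i) = Pi.basisFun ℝ (Fin n) i := by
    ext k
    simp [T, Pi.single_apply, eq_comm]
  rw [h2] at h1
  simpa [Function.comp_def, hT] using h1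

variable [Fintype ι]

/-- Square summability of w ↦ φ·A_w x is stable under linear combinations in φ and in x. It
therefore suffices to take φ a row of C A_v and x = A_{w'} B_j, where the function is a coordinate
of S_j(w' w v), a subfamily along an injective map. -/
theorem summable_sq (h : IsMinimalRepresentation S C A B) (hS : IsSquareSummable S)
    (i k : Fin n) : Summable fun w => wordProd A w i k ^ 2 := by
  have hadd : ∀ {f g : List ι → ℝ}, Summable (fun w => f w ^ 2) → Summable (fun w => g w ^ 2) →
      Summable fun w => (f w + g w) ^ 2 := fun {f g} hf hg =>
    Summable.of_nonneg_of_le (fun w => sq_nonneg _)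
      (fun w => by nlinarith [sq_nonneg (f w - g w)]) ((hf.add hg).mul_left 2)
  have hsmul : ∀ {f : List ι → ℝ} (c : ℝ), Summable (fun w => f w ^ 2) →
      Summable fun w => (c * f w) ^ 2 := fun {f} c hf => by
    simpa only [mul_pow] using hf.mul_left (c ^ 2)
  have h1 : ∀ j l, Summable fun w => S j w l ^ 2 := by
    intro j l
    have := (summable_words_iff fun w => Finset.sum_nonneg fun i _ => sq_nonneg _).2
      ((isSquareSummableSeries_iff (S j)).1 (hS j))
    exact Summable.of_nonneg_of_le (fun w => sq_nonneg _)
      (fun w => Finset.single_le_sum (f := fun i => S j w i ^ 2) (fun i _ => sq_nonneg _)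
        (Finset.mem_univ l)) this
  have h2 : ∀ (φ : Fin n → ℝ) (x : Fin n → ℝ),
      Summable fun w => (φ ⬝ᵥ (wordProd A w *ᵥ x)) ^ 2 := by
    intro φ x
    have hφ : φ ∈ Submodule.span ℝ
      (Set.range fun x : List ι × Fin p => (C * wordProd A x.1) x.2) := by
      rw [h.span_rows]; trivial
    have hx : x ∈ Submodule.span ℝ
      (Set.range fun x : J × List ι => wordProd A x.2 *ᵥ B x.1) := by
      rw [h.reachable]; trivial
    induction hφ using Submodule.span_induction with
    | zero => simp
    | add φ ψ _ _ h1 h2 => simpa only [add_dotProduct] using hadd h1 h2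
    | smul c φ _ h1 => simpa only [smul_dotProduct, smul_eq_mul] using hsmul c h1
    | mem φ hφ =>
      obtain ⟨⟨v, l⟩, rfl⟩ := hφ
      induction hx using Submodule.span_induction with
      | zero => simp
      | add x y _ _ h1 h2 => simpa only [mulVec_add, dotProduct_add] using hadd h1 h2
      | smul c x _ h1 =>
        simpa only [mulVec_smul, dotProduct_smul, smul_eq_mul] using hsmul c h1
      | mem x hx =>
        obtain ⟨⟨j, w'⟩, rfl⟩ := hx
        have h3 : ∀ w, (C * wordProd A v) l ⬝ᵥ (wordProd A w *ᵥ (wordProd A w' *ᵥ B j)) =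
            S j (w' ++ w ++ v) l := by
          intro w
          rw [h.apply_eq, wordProd_append, wordProd_append]
          simp only [← Matrix.mulVec_mulVec]
          rw [Matrix.mulVec_mulVec _ C (wordProd A v)]
          rfl
        simp only [h3]
        exact (h1 j l).comp_injective (i := fun w => w' ++ w ++ v) fun a b hab => by simpa using hab
  simpa using h2 (Pi.single i 1) (Pi.single k 1)

end IsMinimalRepresentation

end Minimal

open scoped InnerProductSpace

/-! ### Operators defined on generating families of a Hilbert space -/

section Hilbert

variable {E : Type*} [NormedAddCommGroup E] [InnerProductSpace ℝ E]

/-- The closed subspace generated by `s`. -/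
abbrev closedSpan (s : Set E) : Submodule ℝ E := (Submodule.span ℝ s).topologicalClosure

theorem subset_closedSpan {s : Set E} {f : E} (hf : f ∈ s) : f ∈ closedSpan s :=
  Submodule.le_topologicalClosure _ (Submodule.subset_span hf)

theorem closedSpan_le {s : Set E} {K : Submodule ℝ E} (hK : IsClosed (K : Set E))
    (h : ∀ f ∈ s, f ∈ K) : closedSpan s ≤ K :=
  Submodule.topologicalClosure_minimal _ (Submodule.span_le.2 h) hK

theorem map_mem_closedSpan {s : Set E} {K : Submodule ℝ E} (hK : IsClosed (K : Set E))
    (T : E →L[ℝ] E) (h : ∀ f ∈ s, T f ∈ K) : ∀ f ∈ closedSpan s, T f ∈ K :=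
  closedSpan_le (K := K.comap (T : E →ₗ[ℝ] E)) (hK.preimage T.continuous) h

theorem eq_on_closedSpan {F : Type*} [NormedAddCommGroup F] [NormedSpace ℝ F] {s : Set E}
    (S T : E →L[ℝ] F) (h : ∀ f ∈ s, S f = T f) : ∀ f ∈ closedSpan s, S f = T f := by
  intro f hf
  have := closedSpan_le (K := (S - T).toLinearMap.ker) ((S - T).isClosed_ker)
    (fun f hf => by simp [h f hf]) hf
  simpa [sub_eq_zero] using this

/-- Four operators are allowed so that one density argument covers isometry (`S'` and `T'` the
identity) and orthogonality (`S'` and `T'` zero). -/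
theorem inner_eq_on_closedSpan {s t : Set E} (S T S' T' : E →L[ℝ] E)
    (h : ∀ f ∈ s, ∀ g ∈ t, ⟪S f, T g⟫_ℝ = ⟪S' f, T' g⟫_ℝ) :
    ∀ f ∈ closedSpan s, ∀ g ∈ closedSpan t, ⟪S f, T g⟫_ℝ = ⟪S' f, T' g⟫_ℝ := by
  have h1 : ∀ f ∈ s, ∀ g ∈ closedSpan t, ⟪S f, T g⟫_ℝ = ⟪S' f, T' g⟫_ℝ := fun f hf =>
    eq_on_closedSpan ((innerSL ℝ (S f)).comp T) ((innerSL ℝ (S' f)).comp T') (h f hf)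
  intro f hf g hg
  have := eq_on_closedSpan ((innerSL ℝ (T g)).comp S) ((innerSL ℝ (T' g)).comp S')
    (fun f hf => by
      simpa [real_inner_comm] using h1 f hf g hg) f hf
  simpa [real_inner_comm] using this

theorem inner_eq_zero_on_closedSpan {s t : Set E} (h : ∀ f ∈ s, ∀ g ∈ t, ⟪f, g⟫_ℝ = 0) :
    ∀ f ∈ closedSpan s, ∀ g ∈ closedSpan t, ⟪f, g⟫_ℝ = 0 := by
  intro f hf g hg
  simpa using inner_eq_on_closedSpan (.id ℝ E) (.id ℝ E) 0 0 (by simpa using h) f hf g hg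

variable [CompleteSpace E]

/-- The `Z a` may be linearly dependent; the estimate ‖e' c‖ ≤ ‖e c‖ gives both well-definedness and
the bound. The Gram identity is needed for only one good index because bad indices contribute
nothing to e' c. -/
theorem exists_contraction {J : Type*} (Z Z' : J → E) (good : Set J)
    (h0 : ∀ a ∉ good, Z' a = 0) (h1 : ∀ a ∈ good, ∀ b, ⟪Z' a, Z' b⟫_ℝ = ⟪Z a, Z b⟫_ℝ) :
    ∃ T : E →L[ℝ] E, (∀ f, ‖T f‖ ≤ ‖f‖) ∧ ∀ a, T (Z a) = Z' a := by
  classical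
  let e : (J →₀ ℝ) →ₗ[ℝ] E := Finsupp.linearCombination ℝ Z
  let e' : (J →₀ ℝ) →ₗ[ℝ] E := Finsupp.linearCombination ℝ Z'
  have hin : ∀ c d : J →₀ ℝ, (∀ a ∈ c.support, a ∈ good) → ⟪e' c, e' d⟫_ℝ = ⟪e c, e d⟫_ℝ := by
    intro c d hc
    simp only [e, e', Finsupp.linearCombination_apply, Finsupp.sum, sum_inner, inner_sum,
      real_inner_smul_left, real_inner_smul_right]
    refine Finset.sum_congr rfl fun b _ => Finset.sum_congr rfl fun a ha => ?_
    rw [h1 a (hc a ha)]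
  have hle : ∀ c, ‖e' c‖ ≤ ‖e c‖ := by
    intro c
    let c₁ := c.filter (· ∈ good)
    have hsupp : ∀ a ∈ c₁.support, a ∈ good := by
      intro a ha
      have : c a ≠ 0 ∧ a ∈ good := by simpa [c₁] using ha
      exact this.2
    have hc₁ : e' c = e' c₁ := by
      conv_lhs => rw [← Finsupp.filter_add_filter_not c (· ∈ good), map_add]
      rw [add_eq_left]
      simp only [e', Finsupp.linearCombination_apply, Finsupp.sum]
      refine Finset.sum_eq_zero fun a ha => ?_
      have : c a ≠ 0 ∧ a ∉ good := by simpa using ha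
      rw [h0 a this.2, smul_zero]
    -- With c₁ the good part of c, ‖e' c‖² = ⟨e c₁, e c⟩ ≤ ‖e c₁‖ ‖e c‖ and ‖e c₁‖ = ‖e' c‖; one
    -- factor then cancels.
    have h2 : ‖e' c‖ * ‖e' c‖ = ⟪e c₁, e c⟫_ℝ := by
      rw [← hin _ _ hsupp, ← hc₁, real_inner_self_eq_norm_mul_norm]
    have h3 : ‖e' c‖ = ‖e c₁‖ := by
      have : ‖e' c‖ * ‖e' c‖ = ‖e c₁‖ * ‖e c₁‖ := by
        rw [← real_inner_self_eq_norm_mul_norm (e c₁), ← hin _ _ hsupp, ← hc₁,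
          real_inner_self_eq_norm_mul_norm]
      exact (mul_self_inj (norm_nonneg _) (norm_nonneg _)).1 this
    have h4 := real_inner_le_norm (e c₁) (e c)
    rw [← h2, ← h3] at h4
    rcases (norm_nonneg (e' c)).eq_or_lt with h | h
    · rw [← h]; positivity
    · exact le_of_mul_le_mul_left h4 h
  let K : Submodule ℝ E := (LinearMap.range e).topologicalClosure
  have hK : IsClosed (K : Set E) := Submodule.isClosed_topologicalClosure _
  have : CompleteSpace K := hK.completeSpace_coe
  let ι₀ : (J →₀ ℝ) →ₗ[ℝ] K := e.codRestrict K fun c =>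
    Submodule.le_topologicalClosure _ (LinearMap.mem_range_self e c)
  have hd : DenseRange ι₀ := by
    rw [DenseRange, Subtype.dense_iff]
    intro x hx
    have hx' : x ∈ closure (LinearMap.range e : Set E) := by
      simpa [K, Submodule.topologicalClosure_coe] using hx
    refine closure_mono ?_ hx'
    rintro _ ⟨c, rfl⟩
    exact ⟨ι₀ c, ⟨c, rfl⟩, rfl⟩
  have hle' : ∀ c, ‖e' c‖ ≤ 1 * ‖ι₀ c‖ := fun c => by simpa [ι₀] using hle c
  -- Precomposing with the orthogonal projection onto the closed span gives an operator on the whole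
  -- space without increasing norms.
  refine ⟨(e'.extendOfNorm ι₀).comp K.orthogonalProjectionOnto, fun f => ?_, fun a => ?_⟩
  · refine (LinearMap.norm_extendOfNorm_apply_le hd 1 hle' _).trans ?_
    rw [one_mul]
    exact K.norm_orthogonalProjectionOnto_apply_le f
  · have hz : Z a = (ι₀ (Finsupp.single a 1) : E) := by simp [ι₀, e]
    rw [ContinuousLinearMap.comp_apply, hz, Submodule.orthogonalProjectionOnto_mem_subspace_eq_self,
      LinearMap.extendOfNorm_eq hd ⟨1, hle'⟩]
    simp [e']

end Hilbert

/-! ### Random variables as elements of `L²` -/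

section L2

variable {Ω : Type*} [MeasurableSpace Ω] (P : Measure Ω)

open Classical in
/-- The class of `X` in `L²`, and `0` if `X` is not square integrable. -/
def toL2 (X : Ω → ℝ) : Lp ℝ 2 P := if h : MemLp X 2 P then h.toLp X else 0

variable {P}

theorem coeFn_toL2 {X : Ω → ℝ} (h : MemLp X 2 P) : (toL2 P X : Ω → ℝ) =ᵐ[P] X := by
  rw [toL2, dif_pos h]
  exact h.coeFn_toLp

theorem eq_toL2 {X : Ω → ℝ} {f : Lp ℝ 2 P} (h : (f : Ω → ℝ) =ᵐ[P] X) : f = toL2 P X := by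
  have hX : MemLp X 2 P := (memLp_congr_ae h).1 (Lp.memLp f)
  exact Lp.ext (h.trans (coeFn_toL2 hX).symm)

theorem inner_eq_integral {X Y : Ω → ℝ} {f g : Lp ℝ 2 P} (hf : (f : Ω → ℝ) =ᵐ[P] X)
    (hg : (g : Ω → ℝ) =ᵐ[P] Y) : ⟪f, g⟫_ℝ = ∫ ω, X ω * Y ω ∂P := by
  rw [L2.inner_def]
  refine integral_congr_ae ?_
  filter_upwards [hf, hg] with ω h1 h2
  rw [h1, h2]
  simp [mul_comm]

theorem coeFn_sum_smul {κ : Type*} (s : Finset κ) (c : κ → ℝ) (f : κ → Lp ℝ 2 P) :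
    ((∑ i ∈ s, c i • f i : Lp ℝ 2 P) : Ω → ℝ) =ᵐ[P] fun ω => ∑ i ∈ s, c i * f i ω := by
  classical
  induction s using Finset.induction_on with
  | empty => simpa using! Lp.coeFn_zero ℝ 2 P
  | insert a s ha ih =>
    simp only [Finset.sum_insert ha]
    filter_upwards [Lp.coeFn_add (c a • f a) (∑ i ∈ s, c i • f i), Lp.coeFn_smul (c a) (f a), ih]
      with ω h1 h2 h3
    rw [h1, Pi.add_apply, h2, h3]
    rfl

theorem coeFn_sum {κ : Type*} (s : Finset κ) (f : κ → Lp ℝ 2 P) :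
    ((∑ i ∈ s, f i : Lp ℝ 2 P) : Ω → ℝ) =ᵐ[P] fun ω => ∑ i ∈ s, f i ω := by
  simpa using coeFn_sum_smul s (fun _ => 1) f

/-- Multiplication by a fixed random variable is a closed relation on `L²`. -/
theorem isClosed_mul_ae (c : Ω → ℝ) (S T : Lp ℝ 2 P →L[ℝ] Lp ℝ 2 P) :
    IsClosed {f : Lp ℝ 2 P | (T f : Ω → ℝ) =ᵐ[P] fun ω => c ω * S f ω} := by
  refine IsSeqClosed.isClosed fun f g hf hg => ?_
  have h1 : Tendsto (fun n => S (f n)) atTop (𝓝 (S g)) := (S.continuous.tendsto g).comp hg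
  -- The factor c may be unbounded, so the product need not be continuous on L²; almost sure
  -- convergence along a common subsequence replaces continuity.
  obtain ⟨φ, hφ, hφ'⟩ := (tendstoInMeasure_of_tendsto_Lp h1).exists_seq_tendsto_ae
  have h2 : Tendsto (fun n => T (f (φ n))) atTop (𝓝 (T g)) :=
    ((T.continuous.tendsto g).comp hg).comp hφ.tendsto_atTop
  obtain ⟨ψ, hψ, hψ'⟩ := (tendstoInMeasure_of_tendsto_Lp h2).exists_seq_tendsto_ae
  filter_upwards [hφ', hψ', ae_all_iff.2 hf] with ω ha hb hc
  refine tendsto_nhds_unique hb ?_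
  simp only [hc]
  exact (ha.comp hψ.tendsto_atTop).const_mul (c ω)

theorem mul_ae_on_closedSpan (c : Ω → ℝ) (S T : Lp ℝ 2 P →L[ℝ] Lp ℝ 2 P) {s : Set (Lp ℝ 2 P)}
    (h : ∀ f ∈ s, (T f : Ω → ℝ) =ᵐ[P] fun ω => c ω * S f ω) :
    ∀ f ∈ closedSpan s, (T f : Ω → ℝ) =ᵐ[P] fun ω => c ω * S f ω := by
  let K : Submodule ℝ (Lp ℝ 2 P) :=
    { carrier := {f | (T f : Ω → ℝ) =ᵐ[P] fun ω => c ω * S f ω}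
      zero_mem' := by
        simp only [Set.mem_ofPred_eq, map_zero]
        filter_upwards [Lp.coeFn_zero ℝ 2 P] with ω h
        rw [h, Pi.zero_apply, mul_zero]
      add_mem' := by
        intro f g hf hg
        simp only [Set.mem_ofPred_eq, map_add] at hf hg ⊢
        filter_upwards [hf, hg, Lp.coeFn_add (T f) (T g), Lp.coeFn_add (S f) (S g)]
          with ω h1 h2 h3 h4
        rw [h3, h4, Pi.add_apply, Pi.add_apply, h1, h2, mul_add]
      smul_mem' := by
        intro a f hf
        simp only [Set.mem_ofPred_eq, map_smul] at hf ⊢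
        filter_upwards [hf, Lp.coeFn_smul a (T f), Lp.coeFn_smul a (S f)] with ω h1 h2 h3
        rw [h2, h3, Pi.smul_apply, Pi.smul_apply, h1, smul_eq_mul, smul_eq_mul]
        ring }
  exact closedSpan_le (K := K) (isClosed_mul_ae c S T) h

end L2

/-! ### Words of inputs -/

section Words

variable {Ω ι : Type*}

theorem uWord_append (u : ι → ℤ → Ω → ℝ) (w v : List ι) (t : ℤ) (ω : Ω) :
    uWord u (w ++ v) t ω = uWord u w (t - v.length) ω * uWord u v t ω := by
  induction w with
  | nil => simp [uWord]
  | cons σ w ih =>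
    simp only [List.cons_append, uWord, ih, List.length_append, Nat.cast_add, mul_assoc]
    congr 2
    ring

theorem wordWeight_append (wt : ι → ℝ) (w v : List ι) :
    wordWeight wt (w ++ v) = wordWeight wt w * wordWeight wt v := by
  simp [wordWeight]

theorem wordWeight_pos {wt : ι → ℝ} (hwt : ∀ σ, 0 < wt σ) (w : List ι) : 0 < wordWeight wt w := by
  refine List.prod_pos fun a ha => ?_
  obtain ⟨σ, _, rfl⟩ := List.mem_map.1 ha
  exact hwt σ

theorem zPast_nil (wt : ι → ℝ) (u : ι → ℤ → Ω → ℝ) {k : ℕ} (r : ℤ → Ω → (Fin k → ℝ))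
    (t : ℤ) (ω : Ω) : zPast wt u r [] t ω = r t ω := by
  simp [zPast, uWord, wordWeight]

/-- The factor relating `z_{wσ}(t + 1)` to `z_w(t)`. -/
def inputFactor (wt : ι → ℝ) (u : ι → ℤ → Ω → ℝ) (σ : ι) (t : ℤ) (ω : Ω) : ℝ :=
  u σ t ω * (1 / √(wt σ))

theorem zPast_snoc {wt : ι → ℝ} (hwt : ∀ σ, 0 < wt σ) (u : ι → ℤ → Ω → ℝ) {k : ℕ}
    (r : ℤ → Ω → (Fin k → ℝ)) (w : List ι) (σ : ι) (t : ℤ) (ω : Ω) (i : Fin k) :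
    zPast wt u r (w ++ [σ]) (t + 1) ω i = inputFactor wt u σ t ω * zPast wt u r w t ω i := by
  simp only [zPast, uWord_append, wordWeight_append, Pi.smul_apply, smul_eq_mul, inputFactor,
    Real.sqrt_mul (wordWeight_pos hwt w).le]
  have h1 : t + 1 - ((w ++ [σ]).length : ℤ) = t - w.length := by simp
  rw [h1]
  simp [uWord, wordWeight]
  ring

theorem zPast_singleton {wt : ι → ℝ} (hwt : ∀ σ, 0 < wt σ) (u : ι → ℤ → Ω → ℝ) {k : ℕ}
    (r : ℤ → Ω → (Fin k → ℝ)) (σ : ι) (t : ℤ) (ω : Ω) (i : Fin k) :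
    zPast wt u r [σ] (t + 1) ω i = inputFactor wt u σ t ω * r t ω i := by
  have := zPast_snoc hwt u r [] σ t ω i
  rwa [zPast_nil] at this

theorem exists_snoc {w : List ι} (hw : w ≠ []) : ∃ v τ, w = v ++ [τ] :=
  ⟨w.dropLast, w.getLast hw, (List.dropLast_append_getLast hw).symm⟩

variable [MeasurableSpace Ω] {P : Measure Ω} {u : ι → ℤ → Ω → ℝ} {L : Set (List ι)}

/-- Admissibility is a condition on adjacent pairs, so a further letter only tests the last pair.
Single letters are admissible, which covers empty `v`. -/
theorem IsAdmissible.snoc_snoc_mem (hL : IsAdmissible P u L) (v : List ι) (τ σ : ι) :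
    v ++ [τ] ++ [σ] ∈ L ↔ v ++ [τ] ∈ L ∧ [τ, σ] ∈ L := by
  obtain ⟨S, hS⟩ := hL.exists_pairs
  rw [hS _ (by simp), hS [τ, σ] (by simp)]
  rcases v with _ | ⟨a, v⟩
  · simp [hL.letter_mem]
  · have : (a :: (v ++ [τ])).getLast? = some τ := by
      rw [← List.cons_append, List.getLast?_concat]
    rw [hS _ (by simp), List.isChain_append]
    simp [this]

end Words

/-! ### The past of a process in `L²` -/

section Past

variable {Ω ι : Type*} [MeasurableSpace Ω] (P : Measure Ω) (wt : ι → ℝ) (u : ι → ℤ → Ω → ℝ)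
  {k : ℕ} (r : ℤ → Ω → (Fin k → ℝ))

/-- The `i`-th coordinate of `z^r_w(t)` as an element of `L²`; for the empty word this is the
`i`-th coordinate of `r(t)`. -/
def zL (w : List ι) (t : ℤ) (i : Fin k) : Lp ℝ 2 P := toL2 P fun ω => zPast wt u r w t ω i

/-- The closed subspace generated by the coordinates of `z^r_w(0)` for the words `w` with property
`Q`. -/
abbrev wordSpace (Q : List ι → Prop) : Submodule ℝ (Lp ℝ 2 P) :=
  closedSpan {f | ∃ w, Q w ∧ ∃ i, f = zL P wt u r w 0 i}

/-- The past at time `0`. -/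
abbrev past : Submodule ℝ (Lp ℝ 2 P) := wordSpace P wt u r fun w => w ≠ []

/-- The part of the past generated by the words with last letter `τ`. -/
abbrev lastSpace (τ : ι) : Submodule ℝ (Lp ℝ 2 P) :=
  wordSpace P wt u r fun w => ∃ v, w = v ++ [τ]

variable {P wt u r}

theorem zL_mem_wordSpace {Q : List ι → Prop} {w : List ι} (hw : Q w) (i : Fin k) :
    zL P wt u r w 0 i ∈ wordSpace P wt u r Q :=
  subset_closedSpan ⟨w, hw, i, rfl⟩

theorem zL_mem_past {w : List ι} (hw : w ≠ []) (i : Fin k) :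
    zL P wt u r w 0 i ∈ past P wt u r :=
  zL_mem_wordSpace (Q := fun w => w ≠ []) hw i

theorem wordSpace_mono {Q Q' : List ι → Prop} (h : ∀ w, Q w → Q' w) :
    wordSpace P wt u r Q ≤ wordSpace P wt u r Q' :=
  Submodule.topologicalClosure_mono (Submodule.span_mono fun _ ⟨w, hw, i, hf⟩ =>
    ⟨w, h w hw, i, hf⟩)

theorem lastSpace_le_past (τ : ι) : lastSpace P wt u r τ ≤ past P wt u r :=
  wordSpace_mono fun w ⟨v, hv⟩ => by simp [hv]

theorem crossCov_apply {k l : ℕ} {X : Ω → Fin k → ℝ} {Y : Ω → Fin l → ℝ} {i : Fin k} {j : Fin l}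
    {f g : Lp ℝ 2 P} (hf : (f : Ω → ℝ) =ᵐ[P] fun ω => X ω i)
    (hg : (g : Ω → ℝ) =ᵐ[P] fun ω => Y ω j) : crossCov P X Y i j = ⟪f, g⟫_ℝ :=
  (inner_eq_integral hf hg).symm

namespace IsRC

variable {L : Set (List ι)}

theorem memLp_z (hr : IsRC P wt u L r) (w : List ι) (t : ℤ) (i : Fin k) :
    MemLp (fun ω => zPast wt u r w t ω i) 2 P := by
  rcases eq_or_ne w [] with rfl | hw
  · simpa only [zPast_nil] using hr.sqInt t i
  · exact hr.sqInt_z w hw t i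

theorem coeFn_zL (hr : IsRC P wt u L r) (w : List ι) (t : ℤ) (i : Fin k) :
    (zL P wt u r w t i : Ω → ℝ) =ᵐ[P] fun ω => zPast wt u r w t ω i :=
  coeFn_toL2 (hr.memLp_z w t i)

theorem coeFn_zL_nil (hr : IsRC P wt u L r) (t : ℤ) (i : Fin k) :
    (zL P wt u r [] t i : Ω → ℝ) =ᵐ[P] fun ω => r t ω i := by
  simpa only [zPast_nil] using hr.coeFn_zL [] t i

theorem covT_apply (hr : IsRC P wt u L r) (w v : List ι) (t : ℤ) (i j : Fin k) :
    covT P wt u r w v t i j = ⟪zL P wt u r w t i, zL P wt u r v t j⟫_ℝ :=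
  crossCov_apply (hr.coeFn_zL w t i) (hr.coeFn_zL v t j)

theorem covLam_apply (hr : IsRC P wt u L r) (w : List ι) (t : ℤ) (i j : Fin k) :
    covLam P wt u r w t i j = ⟪zL P wt u r [] t i, zL P wt u r w t j⟫_ℝ :=
  crossCov_apply (hr.coeFn_zL_nil t i) (hr.coeFn_zL w t j)

theorem covT_eq (hr : IsRC P wt u L r) {w v : List ι} (hw : w ≠ []) (hv : v ≠ []) (t : ℤ) :
    covT P wt u r w v t = covT P wt u r w v 0 := by
  simpa using hr.stat_T w v hw hv 0 t

theorem covLam_eq (hr : IsRC P wt u L r) {w : List ι} (hw : w ≠ []) (t : ℤ) :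
    covLam P wt u r w t = covLam P wt u r w 0 := by
  simpa using hr.stat_lam w hw 0 t

theorem zL_eq_zero (hr : IsRC P wt u L r) (hL : IsAdmissible P u L) {w : List ι} (hw : w ≠ [])
    (hwL : w ∉ L) (t : ℤ) (i : Fin k) : zL P wt u r w t i = 0 := by
  refine Lp.ext ((hr.coeFn_zL w t i).trans ?_)
  filter_upwards [hL.zero_of_not_mem w hw hwL (t - 1), Lp.coeFn_zero ℝ 2 P] with ω h1 h2
  rw [h2]
  simp [zPast, h1]

theorem inner_zL_of_ne (hr : IsRC P wt u L r) {σ σ' : ι} (h : σ ≠ σ') (w v : List ι) (t : ℤ)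
    (i j : Fin k) : ⟪zL P wt u r (w ++ [σ]) t i, zL P wt u r (v ++ [σ']) t j⟫_ℝ = 0 := by
  rw [← hr.covT_apply]
  rcases eq_or_ne w [] with rfl | hw <;> rcases eq_or_ne v [] with rfl | hv
  · simp [hr.T_letters σ σ' h]
  · rw [hr.covT_apply, real_inner_comm, ← hr.covT_apply]
    simp [hr.T_letter_ne v hv σ' σ h.symm]
  · simp [hr.T_letter_ne w hw σ σ' h]
  · simp [hr.T_ne w v hw hv σ σ' h]

theorem lastSpace_orthogonal (hr : IsRC P wt u L r) {σ σ' : ι} (h : σ ≠ σ') :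
    ∀ f ∈ lastSpace P wt u r σ, ∀ g ∈ lastSpace P wt u r σ', ⟪f, g⟫_ℝ = 0 :=
  inner_eq_zero_on_closedSpan (by
    rintro _ ⟨_, ⟨w, rfl⟩, i, rfl⟩ _ ⟨_, ⟨v, rfl⟩, j, rfl⟩
    exact hr.inner_zL_of_ne h w v 0 i j)

end IsRC

variable (P wt u r) in
/-- The time shifts and the multiplications by the inputs, as operators on the past at time `0`. -/
structure PastModel where
  shift : ℤ → Lp ℝ 2 P →L[ℝ] Lp ℝ 2 P
  mul : ι → Lp ℝ 2 P →L[ℝ] Lp ℝ 2 P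
  shift_zL : ∀ t w i, w ≠ [] → shift t (zL P wt u r w 0 i) = zL P wt u r w t i
  mul_zL : ∀ σ w i, w ≠ [] → mul σ (zL P wt u r w 0 i) = zL P wt u r (w ++ [σ]) 0 i
  norm_mul_le : ∀ σ f, ‖mul σ f‖ ≤ ‖f‖

/-- For the shifts every index is good, by stationarity. For multiplication by σ the good words are
those with wσ ∈ L: `T_eq` needs admissibility of only one of the two words, and the remaining z_{wσ}
vanish. -/
theorem IsRC.nonempty_pastModel {L : Set (List ι)} (hr : IsRC P wt u L r)
    (hL : IsAdmissible P u L) : Nonempty (PastModel P wt u r) := by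
  let J := {w : List ι // w ≠ []} × Fin k
  have h1 : ∀ t : ℤ, ∃ T : Lp ℝ 2 P →L[ℝ] Lp ℝ 2 P, (∀ f, ‖T f‖ ≤ ‖f‖) ∧
      ∀ a : J, T (zL P wt u r a.1.1 0 a.2) = zL P wt u r a.1.1 t a.2 := fun t =>
    exists_contraction (fun a : J => zL P wt u r a.1.1 0 a.2)
      (fun a : J => zL P wt u r a.1.1 t a.2) Set.univ (by simp) fun a _ b => by
      rw [← hr.covT_apply, ← hr.covT_apply, hr.covT_eq a.1.2 b.1.2]
  have h2 : ∀ σ : ι, ∃ T : Lp ℝ 2 P →L[ℝ] Lp ℝ 2 P, (∀ f, ‖T f‖ ≤ ‖f‖) ∧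
      ∀ a : J, T (zL P wt u r a.1.1 0 a.2) = zL P wt u r (a.1.1 ++ [σ]) 0 a.2 := fun σ =>
    exists_contraction (fun a : J => zL P wt u r a.1.1 0 a.2)
      (fun a : J => zL P wt u r (a.1.1 ++ [σ]) 0 a.2) {a | a.1.1 ++ [σ] ∈ L}
      (fun a ha => hr.zL_eq_zero hL (by simp) ha 0 a.2) fun a ha b => by
      rw [← hr.covT_apply, ← hr.covT_apply, hr.T_eq _ _ a.1.2 b.1.2 σ (Or.inl ha)]
  choose U _ hU using h1
  choose M hM' hM using h2
  exact ⟨⟨U, M, fun t w i hw => hU t (⟨w, hw⟩, i), fun σ w i hw => hM σ (⟨w, hw⟩, i), hM'⟩⟩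

/-! ### Isometry, orthogonality and pathwise rules for shifts and multiplications. -/

namespace PastModel

variable {L : Set (List ι)} (m : PastModel P wt u r)

theorem mul_mem_lastSpace (σ : ι) : ∀ f ∈ past P wt u r, m.mul σ f ∈ lastSpace P wt u r σ :=
  map_mem_closedSpan (Submodule.isClosed_topologicalClosure _) _ (by
    rintro _ ⟨w, hw, i, rfl⟩
    rw [m.mul_zL σ w i hw]
    exact zL_mem_wordSpace ⟨w, rfl⟩ i)

theorem mul_mem_past (σ : ι) {f : Lp ℝ 2 P} (hf : f ∈ past P wt u r) : m.mul σ f ∈ past P wt u r :=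
  lastSpace_le_past σ (m.mul_mem_lastSpace σ f hf)

theorem inner_shift (hr : IsRC P wt u L r) (t : ℤ) : ∀ f ∈ past P wt u r, ∀ g ∈ past P wt u r,
    ⟪m.shift t f, m.shift t g⟫_ℝ = ⟪f, g⟫_ℝ :=
  inner_eq_on_closedSpan _ _ (.id ℝ _) (.id ℝ _) (by
    rintro _ ⟨w, hw, i, rfl⟩ _ ⟨v, hv, j, rfl⟩
    simp only [m.shift_zL t _ _ hw, m.shift_zL t _ _ hv, ContinuousLinearMap.id_apply]
    rw [← hr.covT_apply, ← hr.covT_apply, hr.covT_eq hw hv])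

theorem shift_zero : ∀ f ∈ past P wt u r, m.shift 0 f = f :=
  eq_on_closedSpan _ (.id ℝ _) (by
    rintro _ ⟨w, hw, i, rfl⟩
    exact m.shift_zL 0 w i hw)

theorem shift_injective (hr : IsRC P wt u L r) (t : ℤ) {f g : Lp ℝ 2 P} (hf : f ∈ past P wt u r)
    (hg : g ∈ past P wt u r) (h : m.shift t f = m.shift t g) : f = g := by
  have := m.inner_shift hr t (f - g) (Submodule.sub_mem _ hf hg) (f - g) (Submodule.sub_mem _ hf hg)
  rw [map_sub, h, sub_self, inner_zero_left] at this
  exact sub_eq_zero.1 (inner_self_eq_zero.1 this.symm)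

theorem inner_nil_shift (hr : IsRC P wt u L r) (t : ℤ) (i : Fin k) : ∀ f ∈ past P wt u r,
    ⟪zL P wt u r [] t i, m.shift t f⟫_ℝ = ⟪zL P wt u r [] 0 i, f⟫_ℝ :=
  eq_on_closedSpan ((innerSL ℝ (zL P wt u r [] t i)).comp (m.shift t))
    (innerSL ℝ (zL P wt u r [] 0 i)) (by
    rintro _ ⟨w, hw, j, rfl⟩
    simp only [ContinuousLinearMap.comp_apply, innerSL_apply_apply, m.shift_zL t w j hw]
    rw [← hr.covLam_apply, ← hr.covLam_apply, hr.covLam_eq hw])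

/-- Admissibility of the pair τσ extends every admissible word ending in τ; the inadmissible ones
contribute 0 to both sides. The second vector can be any element of the past. -/
theorem inner_mul_of_mem (hr : IsRC P wt u L r) (hL : IsAdmissible P u L) {τ σ : ι}
    (h : [τ, σ] ∈ L) : ∀ f ∈ lastSpace P wt u r τ, ∀ g ∈ past P wt u r,
      ⟪m.mul σ f, m.mul σ g⟫_ℝ = ⟪f, g⟫_ℝ :=
  inner_eq_on_closedSpan _ _ (.id ℝ _) (.id ℝ _) (by
    rintro _ ⟨_, ⟨w, rfl⟩, i, rfl⟩ _ ⟨v, hv, j, rfl⟩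
    by_cases hw : w ++ [τ] ∈ L
    · simp only [m.mul_zL σ (w ++ [τ]) i (by simp), m.mul_zL σ _ _ hv,
        ContinuousLinearMap.id_apply]
      rw [← hr.covT_apply, ← hr.covT_apply,
        hr.T_eq _ _ (by simp) hv σ (Or.inl ((hL.snoc_snoc_mem _ _ _).2 ⟨hw, h⟩))]
    · simp [hr.zL_eq_zero hL (by simp) hw])

theorem mul_eq_zero_of_not_mem (hr : IsRC P wt u L r) (hL : IsAdmissible P u L) {τ σ : ι}
    (h : [τ, σ] ∉ L) : ∀ f ∈ lastSpace P wt u r τ, m.mul σ f = 0 :=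
  eq_on_closedSpan _ 0 (by
    rintro _ ⟨_, ⟨w, rfl⟩, i, rfl⟩
    rw [m.mul_zL σ (w ++ [τ]) i (by simp)]
    exact hr.zL_eq_zero hL (by simp) (fun h' => h ((hL.snoc_snoc_mem _ _ _).1 h').2) 0 i)

theorem inner_mul_letter (hr : IsRC P wt u L r) (hL : IsAdmissible P u L) {τ σ : ι}
    (h : [τ, σ] ∈ L) (i : Fin k) : ∀ f ∈ lastSpace P wt u r τ,
      ⟪zL P wt u r [σ] 0 i, m.mul σ f⟫_ℝ = ⟪zL P wt u r [] 0 i, f⟫_ℝ :=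
  eq_on_closedSpan ((innerSL ℝ (zL P wt u r [σ] 0 i)).comp (m.mul σ))
    (innerSL ℝ (zL P wt u r [] 0 i)) (by
    rintro _ ⟨_, ⟨w, rfl⟩, j, rfl⟩
    by_cases hw : w ++ [τ] ∈ L
    · simp only [ContinuousLinearMap.comp_apply, innerSL_apply_apply,
        m.mul_zL σ (w ++ [τ]) j (by simp)]
      rw [← hr.covLam_apply, real_inner_comm, ← hr.covT_apply,
        hr.T_letter_eq _ (by simp) σ ((hL.snoc_snoc_mem _ _ _).2 ⟨hw, h⟩), transpose_apply]
    · simp [hr.zL_eq_zero hL (by simp) hw])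

/-- This returns from operators to random variables: it is the recursion `zPast_snoc` on generators,
and multiplication by a random variable is a closed relation. -/
theorem coeFn_shift_mul (hwt : ∀ σ, 0 < wt σ) (hr : IsRC P wt u L r) (σ : ι) (t : ℤ) :
    ∀ f ∈ past P wt u r, (m.shift (t + 1) (m.mul σ f) : Ω → ℝ) =ᵐ[P]
      fun ω => inputFactor wt u σ t ω * m.shift t f ω :=
  mul_ae_on_closedSpan _ (m.shift t) ((m.shift (t + 1)).comp (m.mul σ)) (by
    rintro _ ⟨w, hw, i, rfl⟩
    rw [ContinuousLinearMap.comp_apply, m.mul_zL σ w i hw, m.shift_zL t w i hw,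
      m.shift_zL (t + 1) _ i (by simp)]
    filter_upwards [hr.coeFn_zL w t i, hr.coeFn_zL (w ++ [σ]) (t + 1) i] with ω h1 h2
    rw [h1, h2, zPast_snoc hwt])

theorem integral_shift [IsProbabilityMeasure P] (hr : IsRC P wt u L r) (t : ℤ) :
    ∀ f ∈ past P wt u r, ∫ ω, m.shift t f ω ∂P = 0 := by
  have h1 : MemLp (fun _ : Ω => (1 : ℝ)) 2 P := memLp_const 1
  have h2 : ∀ {g : Lp ℝ 2 P} {X : Ω → ℝ}, (g : Ω → ℝ) =ᵐ[P] X →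
      ⟪toL2 P fun _ => (1 : ℝ), g⟫_ℝ = ∫ ω, X ω ∂P := fun hg => by
    simpa using inner_eq_integral (coeFn_toL2 h1) hg
  intro f hf
  -- The mean is the inner product with the constant 1, hence continuous in f.
  rw [← h2 (EventuallyEq.refl _ _)]
  refine eq_on_closedSpan ((innerSL ℝ (toL2 P fun _ => (1 : ℝ))).comp (m.shift t)) 0 ?_ f hf
  rintro _ ⟨w, hw, i, rfl⟩
  simp only [ContinuousLinearMap.comp_apply, innerSL_apply_apply, m.shift_zL t w i hw]
  rw [h2 (hr.coeFn_zL w t i), hr.mean_zero_z w hw]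
  rfl

theorem pastSpace_eq (hr : IsRC P wt u L r) (t : ℤ) :
    pastSpace P wt u r t = closedSpan {f | ∃ w : List ι, w ≠ [] ∧ ∃ i, f = zL P wt u r w t i} := by
  have : {f : Lp ℝ 2 P | ∃ w : List ι, w ≠ [] ∧ ∃ i : Fin k,
      (f : Ω → ℝ) =ᵐ[P] fun ω => zPast wt u r w t ω i} =
      {f | ∃ w : List ι, w ≠ [] ∧ ∃ i, f = zL P wt u r w t i} := by
    ext f
    refine exists_congr fun w => and_congr_right fun _ => exists_congr fun i => ⟨eq_toL2, ?_⟩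
    rintro rfl
    exact hr.coeFn_zL w t i
  rw [pastSpace, this]

/-- The shift is isometric on the complete space `past`, so the image is closed and contains the
whole closed span at time t. -/
theorem mem_pastSpace_iff (hr : IsRC P wt u L r) (t : ℤ) (g : Lp ℝ 2 P) :
    g ∈ pastSpace P wt u r t ↔ ∃ f ∈ past P wt u r, m.shift t f = g := by
  rw [pastSpace_eq hr]
  constructor
  · let T : past P wt u r →ₗᵢ[ℝ] Lp ℝ 2 P :=
      { toLinearMap := (m.shift t).toLinearMap ∘ₗ (past P wt u r).subtype
        norm_map' := fun f => by
          have := m.inner_shift hr t f f.2 f f.2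
          rw [real_inner_self_eq_norm_sq, real_inner_self_eq_norm_sq] at this
          exact (sq_eq_sq₀ (norm_nonneg _) (norm_nonneg _)).1 this }
    have hT : ((past P wt u r).map (m.shift t).toLinearMap : Set (Lp ℝ 2 P)) = Set.range T := by
      ext f
      constructor
      · rintro ⟨g, hg, rfl⟩
        exact ⟨⟨g, hg⟩, rfl⟩
      · rintro ⟨g, rfl⟩
        exact ⟨g, g.2, rfl⟩
    have hc : IsClosed ((past P wt u r).map (m.shift t).toLinearMap : Set (Lp ℝ 2 P)) := by
      have : CompleteSpace (past P wt u r) :=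
        (Submodule.isClosed_topologicalClosure _).completeSpace_coe
      rw [hT]
      exact T.isometry.isClosedEmbedding.isClosed_range
    intro hg
    refine closedSpan_le hc ?_ hg
    rintro _ ⟨w, hw, i, rfl⟩
    rw [← m.shift_zL t w i hw]
    exact ⟨_, zL_mem_past hw i, rfl⟩
  · rintro ⟨f, hf, rfl⟩
    refine map_mem_closedSpan (Submodule.isClosed_topologicalClosure _) (m.shift t) ?_ f hf
    rintro _ ⟨w, hw, i, rfl⟩
    rw [m.shift_zL t w i hw]
    exact subset_closedSpan ⟨w, hw, i, rfl⟩

end PastModel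

end Past

/-! ### Processes obtained from an RC process by adding a stationary functional of its past -/

section Transform

variable {Ω ι : Type*} [MeasurableSpace Ω] {P : Measure Ω} {wt : ι → ℝ} {u : ι → ℤ → Ω → ℝ}
  {L : Set (List ι)} {k l : ℕ} {r : ℤ → Ω → (Fin k → ℝ)} {s : ℤ → Ω → (Fin l → ℝ)}

namespace PastModel

variable (m : PastModel P wt u r)

/-- Successive multiplication by the letters of a word. -/
def mulWord : List ι → Lp ℝ 2 P →L[ℝ] Lp ℝ 2 P
  | [] => .id ℝ _
  | σ :: w => (mulWord w).comp (m.mul σ)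

theorem mulWord_snoc (w : List ι) (σ : ι) (f : Lp ℝ 2 P) :
    m.mulWord (w ++ [σ]) f = m.mul σ (m.mulWord w f) := by
  induction w generalizing f with
  | nil => simp [mulWord]
  | cons τ w ih => simp [mulWord, ih]

theorem mulWord_mem_past (w : List ι) {f : Lp ℝ 2 P} (hf : f ∈ past P wt u r) :
    m.mulWord w f ∈ past P wt u r := by
  induction w generalizing f with
  | nil => exact hf
  | cons τ w ih => exact ih (m.mul_mem_past τ hf)

variable (f : Fin l → Lp ℝ 2 P) (D : Matrix (Fin l) (Fin k) ℝ)

/-- For `s(t) = f(t) + D r(t)`, the coordinates of `z^s_w(0)` in terms of the past of `r`. -/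
def image : List ι → Fin l → Lp ℝ 2 P
  -- A default value: s(0) itself need not lie in the past of r.
  | [], _ => 0
  | σ :: w, i => m.mulWord w (m.mul σ (f i) + ∑ j, D i j • zL P wt u r [σ] 0 j)

theorem image_singleton (σ : ι) (i : Fin l) :
    m.image f D [σ] i = m.mul σ (f i) + ∑ j, D i j • zL P wt u r [σ] 0 j :=
  rfl

theorem image_snoc {w : List ι} (hw : w ≠ []) (σ : ι) (i : Fin l) :
    m.image f D (w ++ [σ]) i = m.mul σ (m.image f D w i) := by
  cases w with
  | nil => exact absurd rfl hw
  | cons τ w => simp [image, mulWord_snoc]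

/-- The process `s` is the sum of the stationary functional `f` of the past of `r` and of `D r`. -/
structure IsTransform (s : ℤ → Ω → (Fin l → ℝ)) : Prop where
  mem : ∀ i, f i ∈ past P wt u r
  ae_eq : ∀ t i, (fun ω => s t ω i) =ᵐ[P] fun ω => m.shift t (f i) ω + ∑ j, D i j * r t ω j

variable {m f D}

theorem image_mem_lastSpace (hf : ∀ i, f i ∈ past P wt u r) (w : List ι) (σ : ι) (i : Fin l) :
    m.image f D (w ++ [σ]) i ∈ lastSpace P wt u r σ := by
  induction w using List.reverseRecOn generalizing σ with
  | nil =>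
    rw [List.nil_append, image_singleton]
    refine Submodule.add_mem _ (m.mul_mem_lastSpace σ _ (hf i))
      (Submodule.sum_mem _ fun j _ => Submodule.smul_mem _ _ ?_)
    exact zL_mem_wordSpace (Q := fun w => ∃ v, w = v ++ [σ]) ⟨[], rfl⟩ j
  | append_singleton w τ ih =>
    rw [m.image_snoc f D (by simp) σ i]
    exact m.mul_mem_lastSpace σ _ (lastSpace_le_past τ (ih τ))

theorem image_mem_past (hf : ∀ i, f i ∈ past P wt u r) (w : List ι) (i : Fin l) :
    m.image f D w i ∈ past P wt u r := by
  rcases eq_or_ne w [] with rfl | hw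
  · exact Submodule.zero_mem _
  · obtain ⟨v, τ, rfl⟩ := exists_snoc hw
    exact lastSpace_le_past τ (image_mem_lastSpace hf v τ i)

namespace IsTransform

theorem coeFn_nil (h : m.IsTransform f D s) (hr : IsRC P wt u L r) (t : ℤ) (i : Fin l) :
    ((m.shift t (f i) + ∑ j, D i j • zL P wt u r [] t j : Lp ℝ 2 P) : Ω → ℝ) =ᵐ[P]
      fun ω => s t ω i := by
  filter_upwards [h.ae_eq t i, Lp.coeFn_add (m.shift t (f i)) (∑ j, D i j • zL P wt u r [] t j),
    coeFn_sum_smul Finset.univ (D i) fun j => zL P wt u r [] t j,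
    ae_all_iff.2 fun j => hr.coeFn_zL_nil t j] with ω h1 h2 h3 h4
  rw [h1, h2, Pi.add_apply, h3]
  simp only [h4]

/-- Induction on the last letter: appending σ multiplies z^s_w(t) by the input factor, which is also
the action of `mul σ` followed by the shift to t + 1. -/
theorem coeFn_image (h : m.IsTransform f D s) (hwt : ∀ σ, 0 < wt σ) (hr : IsRC P wt u L r)
    {w : List ι} (hw : w ≠ []) (t : ℤ) (i : Fin l) :
    (m.shift t (m.image f D w i) : Ω → ℝ) =ᵐ[P] fun ω => zPast wt u s w t ω i := by
  induction w using List.reverseRecOn generalizing t with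
  | nil => exact absurd rfl hw
  | append_singleton w σ ih =>
    obtain ⟨t, rfl⟩ : ∃ t', t = t' + 1 := ⟨t - 1, by ring⟩
    rcases eq_or_ne w [] with rfl | hw'
    · rw [List.nil_append, image_singleton, map_add, map_sum]
      simp only [map_smul, m.shift_zL (t + 1) [σ] _ (by simp)]
      filter_upwards [Lp.coeFn_add (m.shift (t + 1) (m.mul σ (f i)))
        (∑ j, D i j • zL P wt u r [σ] (t + 1) j),
        coeFn_sum_smul Finset.univ (D i) fun j => zL P wt u r [σ] (t + 1) j,
        ae_all_iff.2 fun j => hr.coeFn_zL [σ] (t + 1) j,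
        m.coeFn_shift_mul hwt hr σ t _ (h.mem i), h.ae_eq t i] with ω h1 h2 h3 h4 h5
      rw [h1, Pi.add_apply, h2, h4, zPast_singleton hwt, h5, mul_add, Finset.mul_sum]
      congr 1
      refine Finset.sum_congr rfl fun j _ => ?_
      rw [h3, zPast_singleton hwt]
      ring
    · rw [m.image_snoc f D hw' σ i]
      filter_upwards [ih hw' t, m.coeFn_shift_mul hwt hr σ t _ (image_mem_past h.mem w i)]
        with ω h1 h2
      rw [h2, h1, zPast_snoc hwt]

variable (h : m.IsTransform f D s) (hwt : ∀ σ, 0 < wt σ) (hr : IsRC P wt u L r)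
include h hwt hr

theorem covT_apply {w v : List ι} (hw : w ≠ []) (hv : v ≠ []) (t : ℤ) (i j : Fin l) :
    covT P wt u s w v t i j = ⟪m.image f D w i, m.image f D v j⟫_ℝ := by
  rw [covT, crossCov_apply (h.coeFn_image hwt hr hw t i) (h.coeFn_image hwt hr hv t j)]
  exact m.inner_shift hr t _ (image_mem_past h.mem w i) _ (image_mem_past h.mem v j)

theorem covLam_apply {w : List ι} (hw : w ≠ []) (t : ℤ) (i j : Fin l) :
    covLam P wt u s w t i j = ⟪f i, m.image f D w j⟫_ℝ +
      ∑ x, D i x * ⟪zL P wt u r [] 0 x, m.image f D w j⟫_ℝ := by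
  have hj := image_mem_past (m := m) (D := D) h.mem w j
  rw [covLam, crossCov_apply (h.coeFn_nil hr t i) (h.coeFn_image hwt hr hw t j), inner_add_left,
    sum_inner, m.inner_shift hr t _ (h.mem i) _ hj]
  simp only [real_inner_smul_left, m.inner_nil_shift hr t _ _ hj]

omit hwt in
theorem integral_eq_zero [IsProbabilityMeasure P] (t : ℤ) (i : Fin l) : ∫ ω, s t ω i ∂P = 0 := by
  rw [integral_congr_ae (h.ae_eq t i), integral_add, integral_finsetSum,
    m.integral_shift hr t _ (h.mem i)]
  · simp [integral_const_mul, hr.mean_zero]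
  · exact fun j _ => ((hr.sqInt t j).integrable one_le_two).const_mul _
  · exact (Lp.memLp _).integrable one_le_two
  · exact integrable_finsetSum _ fun j _ => ((hr.sqInt t j).integrable one_le_two).const_mul _

omit hwt in
theorem inner_image_snoc (hL : IsAdmissible P u L) {w v : List ι} (hw : w ≠ []) (hv : v ≠ [])
    {σ : ι} (hwL : w ++ [σ] ∈ L) (i j : Fin l) :
    ⟪m.image f D (w ++ [σ]) i, m.image f D (v ++ [σ]) j⟫_ℝ =
      ⟪m.image f D w i, m.image f D v j⟫_ℝ := by
  rw [m.image_snoc f D hw σ i, m.image_snoc f D hv σ j]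
  obtain ⟨w, τ, rfl⟩ := exists_snoc hw
  exact m.inner_mul_of_mem hr hL ((hL.snoc_snoc_mem _ _ _).1 hwL).2 _
    (image_mem_lastSpace h.mem w τ i) _ (image_mem_past h.mem v j)

omit hwt in
theorem inner_image_of_ne {σ σ' : ι} (hσ : σ ≠ σ') (w v : List ι) (i j : Fin l) :
    ⟪m.image f D (w ++ [σ]) i, m.image f D (v ++ [σ']) j⟫_ℝ = 0 :=
  hr.lastSpace_orthogonal hσ _ (image_mem_lastSpace h.mem w σ i) _
    (image_mem_lastSpace h.mem v σ' j)

theorem image_eq_zero (hL : IsAdmissible P u L) {w : List ι} (hw : w ≠ []) (hwL : w ∉ L)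
    (i : Fin l) : m.image f D w i = 0 := by
  have h1 := h.coeFn_image hwt hr hw 0 i
  rw [m.shift_zero _ (image_mem_past h.mem w i)] at h1
  refine Lp.ext (h1.trans ?_)
  filter_upwards [hL.zero_of_not_mem w hw hwL (0 - 1), Lp.coeFn_zero ℝ 2 P] with ω h2 h3
  rw [h3]
  simp only [zPast, h2]
  simp

/-- The covariances of s are inner products of the vectors `image`, which do not involve t. The RC
identities then follow from orthogonality of different last letters, isometry along admissible
pairs, and vanishing along inadmissible words. -/
theorem isRC [IsProbabilityMeasure P] (hL : IsAdmissible P u L) : IsRC P wt u L s := by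
  have hmixed : ∀ w v : List ι, w ≠ [] → v ≠ [] → ∀ σ, w ++ [σ] ∈ L → v ++ [σ] ∉ L →
      ∀ i j, ⟪m.image f D v i, m.image f D w j⟫_ℝ = 0 := by
    intro w v hw hv σ hwL hvL i j
    obtain ⟨w, τ, rfl⟩ := exists_snoc hw
    obtain ⟨v, τ', rfl⟩ := exists_snoc hv
    -- Equal last letters: the pair with σ is admissible, so v itself must be inadmissible.
    -- Different last letters: orthogonality.
    rcases eq_or_ne τ' τ with rfl | hτ
    · have h1 := ((hL.snoc_snoc_mem _ _ _).1 hwL).2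
      have h2 : v ++ [τ'] ∉ L := fun h2 => hvL ((hL.snoc_snoc_mem _ _ _).2 ⟨h2, h1⟩)
      rw [h.image_eq_zero hwt hr hL hv h2, inner_zero_left]
    · exact h.inner_image_of_ne hr hτ v w i j
  refine
    { sqInt := fun t i => (memLp_congr_ae (h.coeFn_nil hr t i)).1 (Lp.memLp _)
      sqInt_z := fun w hw t i => (memLp_congr_ae (h.coeFn_image hwt hr hw t i)).1 (Lp.memLp _)
      mean_zero := h.integral_eq_zero hr
      mean_zero_z := fun w hw t i => ?_
      stat_lam := fun w hw t a => ?_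
      stat_T := fun w v hw hv t a => ?_
      T_letters := fun σ σ' hσ t => ?_
      T_eq := fun w v hw hv σ hwv t => ?_
      T_ne := fun w v hw hv σ σ' hσ t => ?_
      T_letter_eq := fun w hw σ hwL t => ?_
      T_letter_ne := fun w hw σ σ' hσ t => ?_
      T_not_mem := fun w v hw hv hwv t => ?_
      T_mixed := fun w v hw hv σ h1 h2 t => ?_
      T_mixed' := fun w v hw hv σ h1 h2 t => ?_ }
  · rw [← integral_congr_ae (h.coeFn_image hwt hr hw t i),
      m.integral_shift hr t _ (image_mem_past h.mem w i)]
  · ext i j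
    rw [h.covLam_apply hwt hr hw, h.covLam_apply hwt hr hw]
  · ext i j
    rw [h.covT_apply hwt hr hw hv, h.covT_apply hwt hr hw hv]
  · ext i j
    rw [h.covT_apply hwt hr (by simp) (by simp)]
    exact h.inner_image_of_ne hr hσ [] [] i j
  · ext i j
    rw [h.covT_apply hwt hr (by simp) (by simp), h.covT_apply hwt hr hw hv]
    rcases hwv with hwL | hvL
    · exact h.inner_image_snoc hr hL hw hv hwL i j
    · rw [real_inner_comm, h.inner_image_snoc hr hL hv hw hvL j i, real_inner_comm]
  · ext i j
    rw [h.covT_apply hwt hr (by simp) (by simp)]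
    exact h.inner_image_of_ne hr hσ w v i j
  · ext i j
    rw [h.covT_apply hwt hr (by simp) (by simp), transpose_apply, h.covLam_apply hwt hr hw,
      m.image_snoc f D hw σ i, image_singleton, inner_add_right, inner_sum]
    obtain ⟨w, τ, rfl⟩ := exists_snoc hw
    have hτ := ((hL.snoc_snoc_mem _ _ _).1 hwL).2
    have hm := image_mem_lastSpace (m := m) (D := D) h.mem w τ i
    -- Cancelling the multiplication by σ turns the two parts of z^s_σ(0) into f and D r(0), that
    -- is, into s(0).
    rw [m.inner_mul_of_mem hr hL hτ _ hm _ (h.mem j), real_inner_comm]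
    congr 1
    refine Finset.sum_congr rfl fun x _ => ?_
    rw [real_inner_smul_right, real_inner_comm, m.inner_mul_letter hr hL hτ x _ hm]
  · ext i j
    rw [h.covT_apply hwt hr (by simp) (by simp)]
    exact h.inner_image_of_ne hr hσ w [] i j
  · ext i j
    rw [h.covT_apply hwt hr hw hv]
    rcases hwv with hwL | hvL
    · rw [h.image_eq_zero hwt hr hL hw hwL, inner_zero_left]; rfl
    · rw [h.image_eq_zero hwt hr hL hv hvL, inner_zero_right]; rfl
  · ext i j
    rw [h.covT_apply hwt hr hv hw]
    exact hmixed w v hw hv σ h1 h2 i j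
  · ext i j
    rw [h.covT_apply hwt hr hv hw, real_inner_comm]
    exact hmixed v w hv hw σ h1 h2 j i

end IsTransform

end PastModel

end Transform

/-! ### Matrices acting on tuples of vectors -/

section Comb

variable {E F : Type*} [NormedAddCommGroup E] [InnerProductSpace ℝ E] [NormedAddCommGroup F]
  [InnerProductSpace ℝ F] {a b c : ℕ}

/-- The product of a matrix with a tuple of vectors. -/
def comb (A : Matrix (Fin a) (Fin b) ℝ) (g : Fin b → E) (i : Fin a) : E := ∑ j, A i j • g j

theorem comb_mem {K : Submodule ℝ E} (A : Matrix (Fin a) (Fin b) ℝ) {g : Fin b → E}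
    (h : ∀ j, g j ∈ K) (i : Fin a) : comb A g i ∈ K :=
  Submodule.sum_mem _ fun j _ => Submodule.smul_mem _ _ (h j)

theorem map_comb (T : E →L[ℝ] F) (A : Matrix (Fin a) (Fin b) ℝ) (g : Fin b → E) (i : Fin a) :
    T (comb A g i) = comb A (fun j => T (g j)) i := by
  simp [comb]

theorem inner_comb_left (A : Matrix (Fin a) (Fin b) ℝ) (g : Fin b → E) (i : Fin a) (e : E) :
    ⟪comb A g i, e⟫_ℝ = (A *ᵥ fun j => ⟪g j, e⟫_ℝ) i := by
  simp [comb, sum_inner, real_inner_smul_left, mulVec, dotProduct]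

theorem comb_sub (A : Matrix (Fin a) (Fin b) ℝ) (g g' : Fin b → E) (i : Fin a) :
    comb A (fun j => g j - g' j) i = comb A g i - comb A g' i := by
  simp [comb, smul_sub]

theorem comb_comb (A : Matrix (Fin a) (Fin b) ℝ) (B : Matrix (Fin b) (Fin c) ℝ) (g : Fin c → E)
    (i : Fin a) : comb A (comb B g) i = comb (A * B) g i := by
  simp only [comb, Finset.smul_sum, smul_smul, Matrix.mul_apply, Finset.sum_smul]
  exact Finset.sum_comm

theorem coeFn_comb {Ω : Type*} [MeasurableSpace Ω] {P : Measure Ω} (A : Matrix (Fin a) (Fin b) ℝ)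
    (g : Fin b → Lp ℝ 2 P) (i : Fin a) :
    ((comb A g i : Lp ℝ 2 P) : Ω → ℝ) =ᵐ[P] fun ω => (A *ᵥ fun j => g j ω) i :=
  coeFn_sum_smul Finset.univ (A i) g

theorem eq_zero_of_mem_closedSpan {s : Set E} {f : E} (hf : f ∈ closedSpan s)
    (h : ∀ g ∈ s, ⟪f, g⟫_ℝ = 0) : f = 0 :=
  inner_self_eq_zero.1 (eq_on_closedSpan (innerSL ℝ f) 0 (by simpa using h) f hf)

end Comb

theorem sqrt_mul_inputFactor {Ω ι : Type*} {wt : ι → ℝ} (hwt : ∀ σ, 0 < wt σ)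
    (u : ι → ℤ → Ω → ℝ) (σ : ι) (t : ℤ) (ω : Ω) : √(wt σ) * inputFactor wt u σ t ω = u σ t ω := by
  have : √(wt σ) ≠ 0 := (Real.sqrt_pos.2 (hwt σ)).ne'
  rw [inputFactor]
  field_simp

/-! ### White noise -/

section Noise

variable {Ω ι : Type*} [MeasurableSpace Ω] {P : Measure Ω} {wt : ι → ℝ} {u : ι → ℤ → Ω → ℝ}
  {L : Set (List ι)} {k : ℕ} {r : ℤ → Ω → (Fin k → ℝ)}

theorem IsRC.inner_zL_eq_zero_of_orth (hr : IsRC P wt u L r)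
    (ho : ∀ w w' : List ι, w ≠ [] → w' ≠ [] → w ≠ w' → ∀ t, covT P wt u r w w' t = 0)
    {w w' : List ι} (hw : w ≠ []) (hw' : w' ≠ []) (h : w ≠ w') (t : ℤ) (i j : Fin k) :
    ⟪zL P wt u r w t i, zL P wt u r w' t j⟫_ℝ = 0 := by
  rw [← hr.covT_apply, ho w w' hw hw' h]
  rfl

/-- If the `z_w` are mutually orthogonal then the noise is orthogonal to its past. -/
theorem IsRC.inner_nil_eq_zero_of_orth [Fintype ι] (hr : IsRC P wt u L r)
    (hwt : ∀ σ, 0 < wt σ) (hu : InputAssumption P u) (hL : IsAdmissible P u L)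
    (ho : ∀ w w' : List ι, w ≠ [] → w' ≠ [] → w ≠ w' → ∀ t, covT P wt u r w w' t = 0)
    (i : Fin k) : ∀ g ∈ past P wt u r, ⟪zL P wt u r [] 0 i, g⟫_ℝ = 0 := by
  refine eq_on_closedSpan (innerSL ℝ (zL P wt u r [] 0 i)) 0 ?_
  rintro _ ⟨w, hw, j, rfl⟩
  by_cases hσ : ∃ σ, w ++ [σ] ∈ L
  · obtain ⟨σ, hσ⟩ := hσ
    have h1 := hr.T_letter_eq w hw σ hσ 0
    rw [ho _ _ (by simp) (by simp) (by simpa using hw)] at h1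
    have h2 := congrFun (congrFun h1 j) i
    rw [transpose_apply, hr.covLam_apply] at h2
    exact h2.symm
  -- No letter can follow w, so every z_{wσ}(1) vanishes; as Σ α_σ u_σ(0) = 1, z_w(0) is a linear
  -- combination of them.
  · push Not at hσ
    obtain ⟨α, hα⟩ := hu.exists_comb
    have : zL P wt u r w 0 j = 0 := by
      refine Lp.ext ((hr.coeFn_zL w 0 j).trans ?_)
      have h1 : ∀ᵐ ω ∂P, ∀ σ, zPast wt u r (w ++ [σ]) (0 + 1) ω j = 0 := ae_all_iff.2 fun σ => by
        have h2 := hr.coeFn_zL (w ++ [σ]) (0 + 1) j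
        rw [hr.zL_eq_zero hL (by simp) (hσ σ)] at h2
        filter_upwards [h2, Lp.coeFn_zero ℝ 2 P] with ω h3 h4
        rw [← h3, h4, Pi.zero_apply]
      filter_upwards [h1, hα 0, Lp.coeFn_zero ℝ 2 P] with ω h2 h3 h4
      rw [h4, Pi.zero_apply, ← one_mul (zPast wt u r w 0 ω j), ← h3, Finset.sum_mul]
      refine Finset.sum_eq_zero fun σ _ => ?_
      have h5 := h2 σ
      rw [zPast_snoc hwt] at h5
      rw [← sqrt_mul_inputFactor hwt u σ 0 ω, mul_assoc, mul_assoc, h5, mul_zero, mul_zero]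
    simp [this]

/-- Conversely, a noise orthogonal to its past has mutually orthogonal `z_w`. -/
theorem IsRC.covT_eq_zero_of_covLam_eq_zero (hr : IsRC P wt u L r)
    (hlam : ∀ w, w ≠ [] → ∀ t, covLam P wt u r w t = 0) :
    ∀ w w' : List ι, w ≠ [] → w' ≠ [] → w ≠ w' → ∀ t, covT P wt u r w w' t = 0 := by
  have hletter : ∀ w : List ι, w ≠ [] → ∀ σ t, covT P wt u r (w ++ [σ]) [σ] t = 0 := by
    intro w hw σ t
    by_cases h : w ++ [σ] ∈ L
    · rw [hr.T_letter_eq w hw σ h, hlam w hw, transpose_zero]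
    · exact hr.T_not_mem _ _ (by simp) (by simp) (Or.inl h) t
  intro w
  -- Strip equal last letters. Different last letters are orthogonal; if one word runs out, what
  -- remains is a value of Λ, hence 0.
  induction w using List.reverseRecOn with
  | nil => exact fun _ h => absurd rfl h
  | append_singleton w σ ih =>
    intro w' _ hw' hne t
    obtain ⟨w', σ', rfl⟩ := exists_snoc hw'
    rcases eq_or_ne σ σ' with rfl | hσ
    · have hne' : w ≠ w' := fun h => hne (by rw [h])
      rcases eq_or_ne w [] with rfl | hw <;> rcases eq_or_ne w' [] with rfl | hv
      · exact absurd rfl hne'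
      · ext i j
        rw [hr.covT_apply, real_inner_comm, ← hr.covT_apply, List.nil_append, hletter w' hv]
        rfl
      · exact hletter w hw σ t
      · by_cases h : w ++ [σ] ∈ L
        · rw [hr.T_eq w w' hw hv σ (Or.inl h), ih w' hw hv hne']
        · exact hr.T_not_mem _ _ (by simp) (by simp) (Or.inl h) t
    · ext i j
      rw [hr.covT_apply, hr.inner_zL_of_ne hσ]
      rfl

end Noise

/-! ### Regular systems -/

section Regular

variable {Ω ι : Type*} [MeasurableSpace Ω] {P : Measure Ω} [Fintype ι] {wt : ι → ℝ}
  {u : ι → ℤ → Ω → ℝ} {L : Set (List ι)} {n k p : ℕ}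

/-- The state at time `0` of a stationary bilinear system driven by the process `r`. -/
structure IsStationaryState {r : ℤ → Ω → (Fin k → ℝ)} (m : PastModel P wt u r)
    (A : ι → Matrix (Fin n) (Fin n) ℝ) (K : ι → Matrix (Fin n) (Fin k) ℝ)
    (f : Fin n → Lp ℝ 2 P) : Prop where
  mem : ∀ i, f i ∈ past P wt u r
  eq_sum : ∀ i, f i = ∑ σ, (comb (A σ) (fun j => m.mul σ (f j)) i +
    comb (K σ) (fun j => zL P wt u r [σ] 0 j) i)

namespace IsStationaryState

variable {r : ℤ → Ω → (Fin k → ℝ)} {m : PastModel P wt u r} {A : ι → Matrix (Fin n) (Fin n) ℝ}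
  {K : ι → Matrix (Fin n) (Fin k) ℝ} {f : Fin n → Lp ℝ 2 P}

theorem inner_last (h : IsStationaryState m A K f) (hr : IsRC P wt u L r) {τ : ι} (i : Fin n)
    {g : Lp ℝ 2 P} (hg : g ∈ lastSpace P wt u r τ) :
    ⟪f i, g⟫_ℝ = (A τ *ᵥ fun j => ⟪m.mul τ (f j), g⟫_ℝ) i +
      (K τ *ᵥ fun j => ⟪zL P wt u r [τ] 0 j, g⟫_ℝ) i := by
  rw [h.eq_sum i, sum_inner, Finset.sum_eq_single τ, inner_add_left, inner_comb_left,
    inner_comb_left]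
  · intro σ _ hσ
    refine hr.lastSpace_orthogonal hσ _ (Submodule.add_mem _ (comb_mem _ (fun j => ?_) i)
      (comb_mem _ (fun j => ?_) i)) _ hg
    · exact m.mul_mem_lastSpace σ _ (h.mem j)
    · exact zL_mem_wordSpace (Q := fun w => ∃ v, w = v ++ [σ]) ⟨[], rfl⟩ j
  · simp

/-- In ⟨f, τ·g⟩ only the summand of the state equation with letter τ survives. Its noise term
vanishes by whiteness, and for an admissible pair κτ the multiplication cancels. -/
theorem inner_mul (h : IsStationaryState m A K f) (hr : IsRC P wt u L r)
    (hL : IsAdmissible P u L)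
    (ho : ∀ w w' : List ι, w ≠ [] → w' ≠ [] → w ≠ w' → ∀ t, covT P wt u r w w' t = 0)
    (hAK : ∀ σ₁ σ₂, [σ₁, σ₂] ∉ L → A σ₂ * A σ₁ = 0 ∧ A σ₂ * K σ₁ * covT P wt u r [σ₁] [σ₁] 0 = 0)
    {κ : ι} {g : Lp ℝ 2 P} (hg : g ∈ lastSpace P wt u r κ) (τ : ι) :
    (fun i => ⟪f i, m.mul τ g⟫_ℝ) = A τ *ᵥ fun j => ⟪f j, g⟫_ℝ := by
  have hg' := lastSpace_le_past κ hg
  have hz : ∀ j, ⟪zL P wt u r [τ] 0 j, m.mul τ g⟫_ℝ = 0 := by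
    intro j
    refine eq_on_closedSpan ((innerSL ℝ (zL P wt u r [τ] 0 j)).comp (m.mul τ)) 0 ?_ g hg'
    rintro _ ⟨w, hw, i, rfl⟩
    simp only [ContinuousLinearMap.comp_apply, innerSL_apply_apply, m.mul_zL τ w i hw]
    exact hr.inner_zL_eq_zero_of_orth ho (by simp) (by simp) (by simpa using hw.symm) 0 j i
  by_cases hκ : [κ, τ] ∈ L
  · funext i
    rw [h.inner_last hr i (m.mul_mem_lastSpace τ g hg')]
    simp only [hz]
    rw [show (fun _ : Fin k => (0 : ℝ)) = 0 from rfl, mulVec_zero, Pi.zero_apply, add_zero]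
    congr 2
    funext j
    rw [real_inner_comm, m.inner_mul_of_mem hr hL hκ g hg _ (h.mem j), real_inner_comm]
  -- Now τ·g = 0, so A_τ⟨f, g⟩ = 0 is required. Expanding ⟨f, g⟩ along the last letter κ leaves A_τ
  -- A_κ and A_τ K_κ, the latter tested only against z_κ, by whiteness.
  · have h1 : (fun j => ⟪f j, g⟫_ℝ) = A κ *ᵥ (fun j => ⟪m.mul κ (f j), g⟫_ℝ) +
        K κ *ᵥ fun j => ⟪zL P wt u r [κ] 0 j, g⟫_ℝ := funext fun i => h.inner_last hr i hg
    have h2 : (A τ * K κ) *ᵥ (fun j => ⟪zL P wt u r [κ] 0 j, g⟫_ℝ) = 0 := by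
      funext i
      rw [← inner_comb_left]
      refine eq_on_closedSpan (innerSL ℝ (comb (A τ * K κ) (zL P wt u r [κ] 0) i)) 0 ?_ g hg
      rintro _ ⟨_, ⟨v, rfl⟩, q, rfl⟩
      rw [innerSL_apply_apply, inner_comb_left]
      rcases eq_or_ne v [] with rfl | hv
      · have := congrFun (congrFun (hAK κ τ hκ).2 i) q
        simpa only [Matrix.mul_apply, mulVec, dotProduct, hr.covT_apply] using! this
      · simp only [hr.inner_zL_eq_zero_of_orth ho (w := [κ]) (w' := v ++ [κ]) (by simp) (by simp)
          (by simpa using hv.symm)]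
        rw [show (fun _ : Fin k => (0 : ℝ)) = 0 from rfl, mulVec_zero]
        rfl
    rw [h1, mulVec_add, mulVec_mulVec, mulVec_mulVec, h2, (hAK κ τ hκ).1, zero_mulVec, add_zero]
    funext i
    rw [m.mul_eq_zero_of_not_mem hr hL hκ g hg, inner_zero_right]
    rfl

theorem inner_image (h : IsStationaryState m A K f) (hr : IsRC P wt u L r)
    (hL : IsAdmissible P u L)
    (ho : ∀ w w' : List ι, w ≠ [] → w' ≠ [] → w ≠ w' → ∀ t, covT P wt u r w w' t = 0)
    (hAK : ∀ σ₁ σ₂, [σ₁, σ₂] ∉ L → A σ₂ * A σ₁ = 0 ∧ A σ₂ * K σ₁ * covT P wt u r [σ₁] [σ₁] 0 = 0)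
    {f' : Fin p → Lp ℝ 2 P} (hf' : ∀ i, f' i ∈ past P wt u r) (D : Matrix (Fin p) (Fin k) ℝ)
    (σ : ι) (w : List ι) (j : Fin p) :
    (fun i => ⟪f i, m.image f' D (σ :: w) j⟫_ℝ) =
      wordProd A w *ᵥ fun i => ⟪f i, m.image f' D [σ] j⟫_ℝ := by
  induction w using List.reverseRecOn with
  | nil => simp [wordProd]
  | append_singleton w τ ih =>
    rw [← List.cons_append, wordProd_snoc, ← mulVec_mulVec, ← ih]
    obtain ⟨v, κ, hv⟩ := exists_snoc (List.cons_ne_nil σ w)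
    simp only [m.image_snoc f' D (List.cons_ne_nil σ w) τ j]
    exact h.inner_mul hr hL ho hAK (by
      rw [hv]
      exact PastModel.image_mem_lastSpace hf' v κ j) τ

end IsStationaryState

variable {B : GBS P u n k p}

namespace GBS.Regular

/-- Pulling x(t) back to time 0 gives vectors f(t) obeying a recursion with constant coefficients.
What has to be shown is that f(t) does not depend on t; this comes from the infinite past and
whiteness. -/
theorem exists_state (hB : B.Regular wt L) (hwt : ∀ σ, 0 < wt σ) (m : PastModel P wt u B.v) :
    ∃ f : Fin n → Lp ℝ 2 P, IsStationaryState m (fun σ => √(wt σ) • B.A σ)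
      (fun σ => √(wt σ) • B.K σ) f ∧
      ∀ t i, (m.shift t (f i) : Ω → ℝ) =ᵐ[P] fun ω => B.x t ω i := by
  have hr := hB.noise_rc
  have h1 : ∀ t i, ∃ f ∈ past P wt u B.v, (m.shift t f : Ω → ℝ) =ᵐ[P] fun ω => B.x t ω i := by
    intro t i
    obtain ⟨g, hg, hgx⟩ := hB.state_mem t i
    obtain ⟨f, hf, rfl⟩ := (m.mem_pastSpace_iff hr t g).1 hg
    exact ⟨f, hf, hgx⟩
  choose f hf hfx using h1
  have hrec : ∀ t i, f (t + 1) i = ∑ σ, (comb (√(wt σ) • B.A σ) (fun j => m.mul σ (f t j)) i +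
      comb (√(wt σ) • B.K σ) (fun j => zL P wt u B.v [σ] 0 j) i) := by
    intro t i
    refine m.shift_injective hr (t + 1) (hf _ _) (Submodule.sum_mem _ fun σ _ =>
      Submodule.add_mem _ (comb_mem _ (fun j => m.mul_mem_past σ (hf t j)) i)
        (comb_mem _ (fun j => zL_mem_past (by simp) j) i)) ?_
    simp only [map_sum, map_add, map_comb, m.shift_zL (t + 1) [_] _ (by simp)]
    refine Lp.ext ?_
    filter_upwards [hfx (t + 1) i, B.state_eq t,
      coeFn_sum Finset.univ fun σ => comb (√(wt σ) • B.A σ)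
        (fun j => m.shift (t + 1) (m.mul σ (f t j))) i +
          comb (√(wt σ) • B.K σ) (fun j => zL P wt u B.v [σ] (t + 1) j) i,
      ae_all_iff.2 fun σ => Lp.coeFn_add (comb (√(wt σ) • B.A σ)
        (fun j => m.shift (t + 1) (m.mul σ (f t j))) i)
          (comb (√(wt σ) • B.K σ) (fun j => zL P wt u B.v [σ] (t + 1) j) i),
      ae_all_iff.2 fun σ => coeFn_comb (√(wt σ) • B.A σ)
        (fun j => m.shift (t + 1) (m.mul σ (f t j))) i,
      ae_all_iff.2 fun σ => coeFn_comb (√(wt σ) • B.K σ)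
        (fun j => zL P wt u B.v [σ] (t + 1) j) i,
      ae_all_iff.2 fun σ => ae_all_iff.2 fun j => m.coeFn_shift_mul hwt hr σ t _ (hf t j),
      ae_all_iff.2 fun σ => ae_all_iff.2 fun j => hr.coeFn_zL [σ] (t + 1) j,
      ae_all_iff.2 fun j => hfx t j] with ω h1 h2 h3 h4 h5 h6 h7 h8 h9
    rw [h1, h2, h3, Finset.sum_apply]
    refine Finset.sum_congr rfl fun σ _ => ?_
    rw [h4, Pi.add_apply, h5, h6]
    simp only [h7, h8, h9, zPast_singleton hwt, Pi.smul_apply, Pi.add_apply, smul_eq_mul, mulVec,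
      dotProduct, Matrix.smul_apply]
    rw [mul_add, Finset.mul_sum, Finset.mul_sum]
    congr 1 <;> refine Finset.sum_congr rfl fun j _ => ?_ <;>
      rw [← sqrt_mul_inputFactor hwt u σ t ω] <;> ring
  -- In a difference the gain terms cancel and each use of the recursion lengthens all words by one
  -- letter. Time has no beginning, so this can be repeated without end.
  have hmem : ∀ (N : ℕ) t i, f (t + 1) i - f t i ∈
      wordSpace P wt u B.v fun w => N < w.length := by
    intro N
    induction N with
    | zero =>
      intro t i
      have : past P wt u B.v ≤ wordSpace P wt u B.v fun w => 0 < w.length :=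
        wordSpace_mono fun w hw => List.length_pos_iff.2 hw
      exact this (Submodule.sub_mem _ (hf _ _) (hf _ _))
    | succ N ih =>
      intro t i
      obtain ⟨t, rfl⟩ : ∃ t', t = t' + 1 := ⟨t - 1, by ring⟩
      have h2 : f (t + 1 + 1) i - f (t + 1) i =
          ∑ σ, comb (√(wt σ) • B.A σ) (fun j => m.mul σ (f (t + 1) j - f t j)) i := by
        rw [hrec (t + 1), hrec t, ← Finset.sum_sub_distrib]
        simp only [map_sub, comb_sub, add_sub_add_right_eq_sub]
      rw [h2]
      refine Submodule.sum_mem _ fun σ _ => comb_mem _ (fun j => ?_) i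
      refine map_mem_closedSpan (Submodule.isClosed_topologicalClosure _) (m.mul σ) ?_ _ (ih t j)
      rintro _ ⟨w, hw, q, rfl⟩
      rw [m.mul_zL σ w q (List.ne_nil_of_length_pos (by omega))]
      exact zL_mem_wordSpace (Q := fun w => N + 1 < w.length) (by simpa using hw) q
  have hstep : ∀ t, f (t + 1) = f t := by
    intro t
    funext i
    refine sub_eq_zero.1 (eq_zero_of_mem_closedSpan (Submodule.sub_mem _ (hf _ _) (hf _ _)) ?_)
    -- The difference lies in the span of words longer than v, all orthogonal to z_v.
    rintro _ ⟨v, hv, q, rfl⟩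
    rw [real_inner_comm]
    refine eq_on_closedSpan (innerSL ℝ (zL P wt u B.v v 0 q)) 0 ?_ _ (hmem v.length t i)
    rintro _ ⟨w, hw, q', rfl⟩
    exact hr.inner_zL_eq_zero_of_orth hB.noise_orth hv (List.ne_nil_of_length_pos (by omega))
      (by rintro rfl; exact lt_irrefl _ hw) 0 q q'
  have hconst : ∀ t, f t = f 0 := by
    intro t
    induction t using Int.induction_on with
    | zero => rfl
    | succ t ih => rw [hstep, ih]
    | pred t ih => rw [← ih, ← hstep, sub_add_cancel]
  refine ⟨f 0, ⟨hf 0, fun i => ?_⟩, fun t i => ?_⟩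
  · conv_lhs => rw [← hconst (0 + 1)]
    exact hrec 0 i
  · rw [← hconst t]
    exact hfx t i

theorem isRC_and_isRational_and_isSquareSummable [IsProbabilityMeasure P] (hB : B.Regular wt L)
    (hwt : ∀ σ, 0 < wt σ) (hu : InputAssumption P u) (hL : IsAdmissible P u L)
    {y : ℤ → Ω → (Fin p → ℝ)} (hy : B.IsRealization y) :
    IsRC P wt u L y ∧ IsRational (Psi P wt u y) ∧ IsSquareSummable (Psi P wt u y) := by
  have hr := hB.noise_rc
  obtain ⟨m⟩ := hr.nonempty_pastModel hL
  obtain ⟨f, hf, hfx⟩ := hB.exists_state hwt m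
  have htr : m.IsTransform (comb B.C f) B.D y :=
    { mem := comb_mem _ hf.mem
      ae_eq := fun t i => by
        rw [map_comb]
        filter_upwards [hy t, coeFn_comb B.C (fun j => m.shift t (f j)) i,
          ae_all_iff.2 fun j => hfx t j] with ω h1 h2 h3
        rw [h1, h2]
        simp only [h3]
        rfl }
  have hAK : ∀ σ₁ σ₂, [σ₁, σ₂] ∉ L → (√(wt σ₂) • B.A σ₂) * (√(wt σ₁) • B.A σ₁) = 0 ∧
      (√(wt σ₂) • B.A σ₂) * (√(wt σ₁) • B.K σ₁) * covT P wt u B.v [σ₁] [σ₁] 0 = 0 := by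
    intro σ₁ σ₂ h
    have := hB.not_mem σ₁ σ₂ h
    simp [this.1, this.2 0]
  have hPsi : ∀ jσ w, Psi P wt u y jσ w = B.C *ᵥ (wordProd (fun σ => √(wt σ) • B.A σ) w *ᵥ
      fun i => ⟪f i, m.image (comb B.C f) B.D [jσ.2] jσ.1⟫_ℝ) := by
    rintro ⟨j, σ⟩ w
    funext i
    rw [Psi, htr.covLam_apply hwt hr (by simp), inner_comb_left,
      hf.inner_image hr hL hB.noise_orth hAK htr.mem B.D σ w j, add_eq_left]
    refine Finset.sum_eq_zero fun x _ => ?_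
    rw [hr.inner_nil_eq_zero_of_orth hwt hu hL hB.noise_orth x _
      (PastModel.image_mem_past htr.mem _ j), mul_zero]
  refine ⟨htr.isRC hwt hr hL, ⟨n, B.C, _, _, hPsi⟩, fun jσ => ?_⟩
  rw [funext (hPsi jσ)]
  refine IsStableMatrix.isSquareSummableSeries ?_ _ _
  have hs := hB.stable
  have : ∀ σ, (√(wt σ) • B.A σ)ᵀ ⊗ₖ (√(wt σ) • B.A σ)ᵀ = wt σ • ((B.A σ)ᵀ ⊗ₖ (B.A σ)ᵀ) := by
    intro σ
    rw [transpose_smul, smul_kronecker, kronecker_smul, smul_smul, Real.mul_self_sqrt (hwt σ).le]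
  simpa only [this] using hs

end GBS.Regular

end Regular

/-! ### The innovation representation -/

/-- Taking expectations identifies the correlation of z^f_v with z_w as Λ_{wv}; this is where future
outputs meet the Hankel structure of Ψ_y. -/
theorem zFuture_mul_zPast {Ω ι : Type*} {p : ℕ} {wt : ι → ℝ} (hwt : ∀ σ, 0 < wt σ) (u : ι → ℤ → Ω → ℝ)
    (y : ℤ → Ω → (Fin p → ℝ)) (v w : List ι) (t : ℤ) (ω : Ω) (i j : Fin p) :
    zFuture wt u y v t ω i * zPast wt u y w t ω j =
      y (t + v.length) ω i * zPast wt u y (w ++ v) (t + v.length) ω j := by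
  simp only [zFuture, zPast, Pi.smul_apply, smul_eq_mul, uWord_append, wordWeight_append,
    Real.sqrt_mul (wordWeight_pos hwt w).le, List.length_append, Nat.cast_add]
  rw [show t + (v.length : ℤ) - 1 - v.length = t - 1 by ring,
    show t + (v.length : ℤ) - (w.length + v.length) = t - w.length by ring]
  simp only [one_div, mul_inv]
  ring

/-- No independence of the vectors is required, so a gain exists even when the innovation covariance
is singular. -/
theorem exists_projection_coeff {E : Type*} [NormedAddCommGroup E] [InnerProductSpace ℝ E]
    {k : ℕ} (g : Fin k → E) (x : E) : ∃ c : Fin k → ℝ, ∀ j, ⟪x - ∑ i, c i • g i, g j⟫_ℝ = 0 := by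
  let K := Submodule.span ℝ (Set.range g)
  have : FiniteDimensional ℝ K := FiniteDimensional.span_of_finite ℝ (Set.finite_range g)
  obtain ⟨c, hc⟩ := (Submodule.mem_span_range_iff_exists_fun ℝ).1
    (Submodule.starProjection_apply_mem K x)
  refine ⟨c, fun j => ?_⟩
  rw [hc, real_inner_comm]
  exact Submodule.sub_starProjection_mem_orthogonal x _ (Submodule.subset_span ⟨j, rfl⟩)

section Innovation

variable {Ω ι : Type*} [MeasurableSpace Ω] {P : Measure Ω} {wt : ι → ℝ}
  {u : ι → ℤ → Ω → ℝ} {L : Set (List ι)} {n p : ℕ} {y : ℤ → Ω → (Fin p → ℝ)}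

theorem IsAdmissible.append_not_mem (hL : IsAdmissible P u L) {w : List ι} (hw : w ≠ [])
    (hwL : w ∉ L) (v : List ι) : w ++ v ∉ L := by
  induction v using List.reverseRecOn with
  | nil => simpa using hwL
  | append_singleton v τ ih =>
    obtain ⟨x, κ, hx⟩ := exists_snoc (w := w ++ v) (by simp [hw])
    rw [← List.append_assoc, hx]
    rw [hx] at ih
    exact fun h => ih ((hL.snoc_snoc_mem _ _ _).1 h).1

theorem IsRC.Psi_eq_zero (hr : IsRC P wt u L y) (hL : IsAdmissible P u L) {σ : ι} {w : List ι}
    (h : σ :: w ∉ L) (j : Fin p) : Psi P wt u y (j, σ) w = 0 := by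
  funext i
  rw [Psi, hr.covLam_apply, hr.zL_eq_zero hL (by simp) h, inner_zero_right]
  rfl

theorem IsRC.memLp_zFuture (hr : IsRC P wt u L y)
    (hy : ∀ w : List ι, w ≠ [] → ∀ t, SqIntegrable P (zFuture wt u y w t)) (w : List ι) (t : ℤ)
    (i : Fin p) : MemLp (fun ω => zFuture wt u y w t ω i) 2 P := by
  rcases eq_or_ne w [] with rfl | hw
  · simpa [zFuture, uWord, wordWeight] using hr.sqInt t i
  · exact hy w hw t i

/-- The state at time `0` obtained by predicting future outputs from the past. -/
structure IsPredictorState (m : PastModel P wt u y) (C : Matrix (Fin p) (Fin n) ℝ)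
    (A : ι → Matrix (Fin n) (Fin n) ℝ) (B : Fin p × ι → Fin n → ℝ) (f : Fin n → Lp ℝ 2 P) :
    Prop where
  minimal : IsMinimalRepresentation (Psi P wt u y) C A B
  mem : ∀ i, f i ∈ past P wt u y
  inner_zL : ∀ σ w l, (fun i => ⟪f i, zL P wt u y (σ :: w) 0 l⟫_ℝ) = wordProd A w *ᵥ B (l, σ)

/-- The vectors φ for which such an f exists form a subspace. It contains each row of C A_v,
realized by projecting a coordinate of z^f_v(0) onto the past, and these rows span. -/
theorem IsMinimalRepresentation.exists_predictorState (hr : IsRC P wt u L y)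
    (hwt : ∀ σ, 0 < wt σ) (hy : ∀ w : List ι, w ≠ [] → ∀ t, SqIntegrable P (zFuture wt u y w t))
    (m : PastModel P wt u y) {C : Matrix (Fin p) (Fin n) ℝ}
    {A : ι → Matrix (Fin n) (Fin n) ℝ} {B : Fin p × ι → Fin n → ℝ}
    (h : IsMinimalRepresentation (Psi P wt u y) C A B) : ∃ f, IsPredictorState m C A B f := by
  have key : ∀ φ : Fin n → ℝ, ∃ f ∈ past P wt u y, ∀ σ w l,
      ⟪f, zL P wt u y (σ :: w) 0 l⟫_ℝ = φ ⬝ᵥ (wordProd A w *ᵥ B (l, σ)) := by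
    intro φ
    have hφ : φ ∈ Submodule.span ℝ
      (Set.range fun x : List ι × Fin p => (C * wordProd A x.1) x.2) := by
      rw [h.span_rows]; trivial
    induction hφ using Submodule.span_induction with
    | zero => exact ⟨0, Submodule.zero_mem _, by simp⟩
    | add φ ψ _ _ h1 h2 =>
      obtain ⟨f, hf, hf'⟩ := h1
      obtain ⟨g, hg, hg'⟩ := h2
      exact ⟨f + g, Submodule.add_mem _ hf hg, fun σ w l => by
        rw [inner_add_left, hf', hg', add_dotProduct]⟩
    | smul c φ _ h1 =>
      obtain ⟨f, hf, hf'⟩ := h1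
      exact ⟨c • f, Submodule.smul_mem _ c hf, fun σ w l => by
        rw [real_inner_smul_left, hf', smul_dotProduct, smul_eq_mul]⟩
    | mem φ hφ =>
      obtain ⟨⟨v, i⟩, rfl⟩ := hφ
      refine ⟨(past P wt u y).starProjection (toL2 P fun ω => zFuture wt u y v 0 ω i),
        Submodule.starProjection_apply_mem _ _, fun σ w l => ?_⟩
      rw [Submodule.inner_starProjection_left_eq_right,
        Submodule.starProjection_eq_self_iff.2 (zL_mem_past (by simp) l),
        inner_eq_integral (coeFn_toL2 (hr.memLp_zFuture hy v 0 i)) (hr.coeFn_zL _ 0 l)]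
      simp only [zFuture_mul_zPast hwt]
      -- The correlation is evaluated at time |v|; stationarity moves it to time 0, where Ψ_y is
      -- defined.
      have h1 : covLam P wt u y (σ :: w ++ v) (0 + v.length) i l = Psi P wt u y (l, σ) (w ++ v) i := by
        rw [hr.covLam_eq (by simp)]
        rfl
      rw [h.apply_eq, wordProd_append, ← mulVec_mulVec, mulVec_mulVec _ C] at h1
      exact h1
  choose f hf hf' using fun i => key (Pi.single i 1)
  refine ⟨f, h, hf, fun σ w l => ?_⟩
  funext i
  rw [hf', single_one_dotProduct]

/-! ### The innovation as a transform of the output, and the state equation. -/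

namespace IsPredictorState

variable {m : PastModel P wt u y} {C : Matrix (Fin p) (Fin n) ℝ}
  {A : ι → Matrix (Fin n) (Fin n) ℝ} {B : Fin p × ι → Fin n → ℝ} {f : Fin n → Lp ℝ 2 P}

theorem inner_snoc (h : IsPredictorState m C A B f) {w : List ι} (hw : w ≠ []) (σ : ι)
    (l : Fin p) : (fun i => ⟪f i, zL P wt u y (w ++ [σ]) 0 l⟫_ℝ) =
      A σ *ᵥ fun i => ⟪f i, zL P wt u y w 0 l⟫_ℝ := by
  cases w with
  | nil => exact absurd rfl hw
  | cons τ w => rw [List.cons_append, h.inner_zL, h.inner_zL, wordProd_snoc, mulVec_mulVec]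

/-- C A_v A_τ A_σ A_w B_j is a value of Ψ_y on a word containing στ, hence 0; reachability and
observability cancel the outer factors. -/
theorem mul_eq_zero (h : IsPredictorState m C A B f) (hr : IsRC P wt u L y)
    (hL : IsAdmissible P u L) {σ τ : ι} (hσ : [σ, τ] ∉ L) : A τ * A σ = 0 := by
  refine h.minimal.mulVec_eq_zero fun w v j => ?_
  have h1 := h.minimal.apply_eq j (w ++ [σ] ++ [τ] ++ v)
  have h2 : j.2 :: (w ++ [σ] ++ [τ] ++ v) ∉ L :=
    hL.append_not_mem (w := (j.2 :: w) ++ [σ] ++ [τ]) (by simp)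
      (fun h' => hσ ((hL.snoc_snoc_mem _ _ _).1 h').2) v
  rw [hr.Psi_eq_zero hL h2 j.1, wordProd_append, wordProd_snoc, wordProd_snoc] at h1
  simpa only [mulVec_mulVec, mul_assoc] using h1.symm

theorem mulVec_eq_zero (h : IsPredictorState m C A B f) (hr : IsRC P wt u L y)
    (hL : IsAdmissible P u L) {σ τ : ι} (hσ : [σ, τ] ∉ L) (l : Fin p) : A τ *ᵥ B (l, σ) = 0 := by
  refine h.minimal.observable _ fun v => ?_
  have h1 := h.minimal.apply_eq (l, σ) (τ :: v)
  have h2 : σ :: τ :: v ∉ L := hL.append_not_mem (w := [σ, τ]) (by simp) hσ v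
  rw [hr.Psi_eq_zero hL h2, wordProd] at h1
  simpa only [mulVec_mulVec, mul_assoc] using h1.symm

/-- `C f` predicts the output from the past. -/
theorem inner_nil (h : IsPredictorState m C A B f) (hr : IsRC P wt u L y) (i : Fin p) :
    ∀ g ∈ past P wt u y, ⟪zL P wt u y [] 0 i, g⟫_ℝ = ⟪comb C f i, g⟫_ℝ := by
  refine eq_on_closedSpan (innerSL ℝ (zL P wt u y [] 0 i)) (innerSL ℝ (comb C f i)) ?_
  rintro _ ⟨w, hw, l, rfl⟩
  cases w with
  | nil => exact absurd rfl hw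
  | cons σ w =>
    rw [innerSL_apply_apply, innerSL_apply_apply, inner_comb_left, h.inner_zL,
      ← h.minimal.apply_eq, ← hr.covLam_apply]
    rfl

theorem coeFn_innovation (h : IsPredictorState m C A B f) (hr : IsRC P wt u L y) (t : ℤ)
    (i : Fin p) : (fun ω => innovation P wt u y t ω i) =ᵐ[P]
      fun ω => y t ω i - m.shift t (comb C f i) ω := by
  have h1 : (pastSpace P wt u y t).starProjection (zL P wt u y [] t i) =
      m.shift t (comb C f i) := by
    refine Submodule.eq_starProjection_of_mem_orthogonal
      ((m.mem_pastSpace_iff hr t _).2 ⟨_, comb_mem C h.mem i, rfl⟩) ?_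
    rw [Submodule.mem_orthogonal']
    intro g hg
    obtain ⟨g, hg', rfl⟩ := (m.mem_pastSpace_iff hr t _).1 hg
    rw [inner_sub_left, m.inner_nil_shift hr t i g hg', h.inner_nil hr i g hg',
      m.inner_shift hr t _ (comb_mem C h.mem i) g hg', sub_self]
  -- Square integrability selects the projection in `projOn` rather than its default value.
  have h2 : MemLp (fun ω => y t ω i) 2 P := hr.sqInt t i
  have h3 : h2.toLp = zL P wt u y [] t i := by
    rw [zL]
    simp only [zPast_nil]
    rw [toL2, dif_pos h2]
  refine Eventually.of_forall fun ω => ?_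
  simp only [innovation, Pi.sub_apply, projOn]
  rw [dif_pos h2, h3, h1]

theorem isTransform (h : IsPredictorState m C A B f) (hr : IsRC P wt u L y) :
    m.IsTransform (fun i => -comb C f i) (1 : Matrix (Fin p) (Fin p) ℝ) (innovation P wt u y) where
  mem i := Submodule.neg_mem _ (comb_mem C h.mem i)
  ae_eq t i := by
    filter_upwards [h.coeFn_innovation hr t i, Lp.coeFn_neg (m.shift t (comb C f i))] with ω h1 h2
    rw [h1, map_neg, h2]
    simp [Matrix.one_apply, sub_eq_neg_add]

variable (m C f) in
/-- The coordinates of `z^e_w(0)` for the innovation process `e`. -/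
abbrev innovationImage : List ι → Fin p → Lp ℝ 2 P :=
  m.image (fun i => -comb C f i) (1 : Matrix (Fin p) (Fin p) ℝ)

theorem innovationImage_singleton (σ : ι) (i : Fin p) :
    innovationImage m C f [σ] i = zL P wt u y [σ] 0 i - comb C (fun j => m.mul σ (f j)) i := by
  rw [innovationImage, PastModel.image_singleton, map_neg, map_comb]
  simp [Matrix.one_apply, sub_eq_neg_add]

/-- C f and y(0) have the same inner products with the past, so the two contributions cancel. -/
theorem covLam_innovation (h : IsPredictorState m C A B f) (hr : IsRC P wt u L y)
    (hwt : ∀ σ, 0 < wt σ) {w : List ι} (hw : w ≠ []) (t : ℤ) :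
    covLam P wt u (innovation P wt u y) w t = 0 := by
  ext i j
  have htr := h.isTransform hr
  have hm := PastModel.image_mem_past (m := m) (D := (1 : Matrix (Fin p) (Fin p) ℝ)) htr.mem w j
  rw [htr.covLam_apply hwt hr hw]
  simp only [h.inner_nil hr _ _ hm]
  simp [Matrix.one_apply]

theorem innovationImage_mem_lastSpace (h : IsPredictorState m C A B f) (hr : IsRC P wt u L y)
    (σ : ι) (i : Fin p) : innovationImage m C f [σ] i ∈ lastSpace P wt u y σ :=
  PastModel.image_mem_lastSpace (h.isTransform hr).mem [] σ i

/-- For an admissible pair τσ, multiplication by σ carries the orthogonality of e(0) to words ending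
in τ over to z^e_σ; otherwise the multiplied word is 0. -/
theorem inner_innovationImage_mul (h : IsPredictorState m C A B f) (hr : IsRC P wt u L y)
    (hL : IsAdmissible P u L) (σ : ι) (i : Fin p) : ∀ g ∈ past P wt u y,
      ⟪innovationImage m C f [σ] i, m.mul σ g⟫_ℝ = 0 := by
  refine eq_on_closedSpan ((innerSL ℝ (innovationImage m C f [σ] i)).comp (m.mul σ)) 0 ?_
  rintro _ ⟨w, hw, q, rfl⟩
  obtain ⟨v, τ, rfl⟩ := exists_snoc hw
  have hz : zL P wt u y (v ++ [τ]) 0 q ∈ lastSpace P wt u y τ :=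
    zL_mem_wordSpace (Q := fun w => ∃ v, w = v ++ [τ]) ⟨v, rfl⟩ q
  rw [ContinuousLinearMap.comp_apply, innerSL_apply_apply, _root_.zero_apply]
  by_cases hτ : [τ, σ] ∈ L
  · rw [innovationImage_singleton, inner_sub_left, m.inner_mul_letter hr hL hτ i _ hz,
      h.inner_nil hr i _ (zL_mem_past hw q), ← map_comb, real_inner_comm _ (m.mul σ (comb C f i)),
      m.inner_mul_of_mem hr hL hτ _ hz _ (comb_mem C h.mem i), real_inner_comm, sub_self]
  · rw [m.mul_eq_zero_of_not_mem hr hL hτ _ hz, inner_zero_right]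

/-- For an inadmissible pair `στ`, the matrix `A τ` kills the correlation of the state with the part
of the past that ends in `σ`. -/
theorem mulVec_inner_eq_zero (h : IsPredictorState m C A B f) (hr : IsRC P wt u L y)
    (hL : IsAdmissible P u L) {σ τ : ι} (hσ : [σ, τ] ∉ L) {g : Lp ℝ 2 P}
    (hg : g ∈ lastSpace P wt u y σ) : (A τ *ᵥ fun i => ⟪f i, g⟫_ℝ) = 0 := by
  funext i
  rw [← inner_comb_left]
  refine eq_on_closedSpan (innerSL ℝ (comb (A τ) f i)) 0 ?_ g hg
  rintro _ ⟨_, ⟨v, rfl⟩, q, rfl⟩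
  rw [innerSL_apply_apply, inner_comb_left]
  rcases eq_or_ne v [] with rfl | hv
  · rw [List.nil_append, h.inner_zL, wordProd, one_mulVec, h.mulVec_eq_zero hr hL hσ]
    rfl
  · rw [h.inner_snoc hv, mulVec_mulVec, h.mul_eq_zero hr hL hσ, zero_mulVec]
    rfl

/-- Both sides equal A_σ⟨f, g⟩ on generators extendable by σ. So f and its one-step update differ on
words ending in σ only along z^e_σ, which the gain supplies. -/
theorem inner_mul (h : IsPredictorState m C A B f) (hr : IsRC P wt u L y)
    (hL : IsAdmissible P u L) (σ : ι) (i : Fin n) : ∀ g ∈ past P wt u y,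
      ⟪f i, m.mul σ g⟫_ℝ = ⟪comb (A σ) (fun j => m.mul σ (f j)) i, m.mul σ g⟫_ℝ := by
  refine eq_on_closedSpan ((innerSL ℝ (f i)).comp (m.mul σ))
    ((innerSL ℝ (comb (A σ) (fun j => m.mul σ (f j)) i)).comp (m.mul σ)) ?_
  rintro _ ⟨w, hw, q, rfl⟩
  obtain ⟨v, τ, rfl⟩ := exists_snoc hw
  have hz : zL P wt u y (v ++ [τ]) 0 q ∈ lastSpace P wt u y τ :=
    zL_mem_wordSpace (Q := fun w => ∃ v, w = v ++ [τ]) ⟨v, rfl⟩ q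
  simp only [ContinuousLinearMap.comp_apply, innerSL_apply_apply]
  by_cases hτ : [τ, σ] ∈ L
  · have h1 : ∀ j, ⟪m.mul σ (f j), m.mul σ (zL P wt u y (v ++ [τ]) 0 q)⟫_ℝ =
        ⟪f j, zL P wt u y (v ++ [τ]) 0 q⟫_ℝ := fun j => by
      rw [real_inner_comm, m.inner_mul_of_mem hr hL hτ _ hz _ (h.mem j), real_inner_comm]
    rw [inner_comb_left]
    simp only [h1]
    rw [m.mul_zL σ _ q hw]
    exact congrFun (h.inner_snoc hw σ q) i
  · rw [m.mul_eq_zero_of_not_mem hr hL hτ _ hz, inner_zero_right, inner_zero_right]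

variable [Fintype ι]

/-- The state equation at time `0`. -/
theorem exists_gain (h : IsPredictorState m C A B f) (hr : IsRC P wt u L y)
    (hL : IsAdmissible P u L) : ∃ K : ι → Matrix (Fin n) (Fin p) ℝ,
      (∀ i, f i = ∑ σ, (comb (A σ) (fun j => m.mul σ (f j)) i +
        comb (K σ) (innovationImage m C f [σ]) i)) ∧
      ∀ σ i j, ⟪comb (K σ) (innovationImage m C f [σ]) i, innovationImage m C f [σ] j⟫_ℝ =
        ⟪f i, innovationImage m C f [σ] j⟫_ℝ := by
  choose κ hκ using fun σ i => exists_projection_coeff (innovationImage m C f [σ]) (f i)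
  have hK : ∀ σ i, comb (Matrix.of (κ σ)) (innovationImage m C f [σ]) i =
      ∑ j, κ σ i j • innovationImage m C f [σ] j := fun σ i => rfl
  have hK' : ∀ σ i j, ⟪comb (Matrix.of (κ σ)) (innovationImage m C f [σ]) i,
      innovationImage m C f [σ] j⟫_ℝ = ⟪f i, innovationImage m C f [σ] j⟫_ℝ := fun σ i j => by
    have := hκ σ i j
    rw [inner_sub_left, sub_eq_zero] at this
    exact this.symm
  refine ⟨fun σ => Matrix.of (κ σ), fun i => ?_, hK'⟩
  have hA : ∀ σ, comb (A σ) (fun j => m.mul σ (f j)) i ∈ lastSpace P wt u y σ := fun σ =>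
    comb_mem _ (fun j => m.mul_mem_lastSpace σ _ (h.mem j)) i
  have hE : ∀ σ, comb (Matrix.of (κ σ)) (innovationImage m C f [σ]) i ∈ lastSpace P wt u y σ :=
    fun σ => comb_mem _ (fun j => h.innovationImage_mem_lastSpace hr σ j) i
  have hlast : ∀ τ, ∀ g ∈ lastSpace P wt u y τ,
      ⟪∑ σ, (comb (A σ) (fun j => m.mul σ (f j)) i +
        comb (Matrix.of (κ σ)) (innovationImage m C f [σ]) i), g⟫_ℝ =
      ⟪comb (A τ) (fun j => m.mul τ (f j)) i, g⟫_ℝ +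
        ⟪comb (Matrix.of (κ τ)) (innovationImage m C f [τ]) i, g⟫_ℝ := by
    intro τ g hg
    rw [sum_inner, Finset.sum_eq_single τ, inner_add_left]
    · exact fun σ _ hσ => hr.lastSpace_orthogonal hσ _ (Submodule.add_mem _ (hA σ) (hE σ)) _ hg
    · simp
  have hmul : ∀ σ, ∀ g ∈ past P wt u y, ⟪f i - ∑ σ, (comb (A σ) (fun j => m.mul σ (f j)) i +
        comb (Matrix.of (κ σ)) (innovationImage m C f [σ]) i), m.mul σ g⟫_ℝ = 0 := by
    intro σ g hg
    rw [inner_sub_left, hlast σ _ (m.mul_mem_lastSpace σ g hg), h.inner_mul hr hL σ i g hg,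
      inner_comb_left (Matrix.of (κ σ))]
    simp only [h.inner_innovationImage_mul hr hL σ _ g hg]
    rw [show (fun _ : Fin p => (0 : ℝ)) = 0 from rfl, mulVec_zero, Pi.zero_apply, add_zero,
      sub_self]
  have hinn : ∀ σ j, ⟪f i - ∑ σ, (comb (A σ) (fun j => m.mul σ (f j)) i +
        comb (Matrix.of (κ σ)) (innovationImage m C f [σ]) i), innovationImage m C f [σ] j⟫_ℝ = 0 := by
    intro σ j
    rw [inner_sub_left, hlast σ _ (h.innovationImage_mem_lastSpace hr σ j), hK' σ i j,
      ← map_comb, real_inner_comm, real_inner_comm _ (m.mul σ (comb (A σ) f i)),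
      h.inner_innovationImage_mul hr hL σ j _ (comb_mem _ h.mem i), zero_add, sub_self]
  refine sub_eq_zero.1 (eq_zero_of_mem_closedSpan (Submodule.sub_mem _ (h.mem i)
    (Submodule.sum_mem _ fun σ _ => lastSpace_le_past σ (Submodule.add_mem _ (hA σ) (hE σ)))) ?_)
  rintro _ ⟨w, hw, q, rfl⟩
  obtain ⟨v, σ, rfl⟩ := exists_snoc hw
  rcases eq_or_ne v [] with rfl | hv
  -- The letter z_σ is not a multiple of an earlier z, so it is split into its innovation and the
  -- multiplied prediction.
  · have h1 : zL P wt u y ([] ++ [σ]) 0 q = innovationImage m C f [σ] q + m.mul σ (comb C f q) := by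
      rw [innovationImage_singleton, map_comb, sub_add_cancel, List.nil_append]
    rw [h1, inner_add_right, hinn, hmul σ _ (comb_mem C h.mem q), add_zero]
  · rw [← m.mul_zL σ v q hv]
    exact hmul σ _ (zL_mem_past hv q)

end IsPredictorState

end Innovation

/-! ### Existence of the realization in forward innovation form -/

section Realization

variable {Ω ι : Type*} [MeasurableSpace Ω] {P : Measure Ω} [Fintype ι] {wt : ι → ℝ}
  {u : ι → ℤ → Ω → ℝ} {L : Set (List ι)} {n p : ℕ} {y : ℤ → Ω → (Fin p → ℝ)}

theorem norm_sum_sq_of_orthogonal {E : Type*} [NormedAddCommGroup E] [InnerProductSpace ℝ E]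
    (g : ι → E) (h : ∀ σ σ', σ ≠ σ' → ⟪g σ, g σ'⟫_ℝ = 0) :
    ‖∑ σ, g σ‖ ^ 2 = ∑ σ, ‖g σ‖ ^ 2 := by
  rw [← real_inner_self_eq_norm_sq, sum_inner]
  refine Finset.sum_congr rfl fun σ _ => ?_
  rw [inner_sum, Finset.sum_eq_single σ, real_inner_self_eq_norm_sq]
  · exact fun σ' _ hσ => h σ σ' hσ.symm
  · simp

/-- Pythagoras over the last letter and contractivity of each multiplication; no factor counting the
words appears. -/
theorem PastModel.norm_wordSum_mulWord_sq_le (m : PastModel P wt u y) (hr : IsRC P wt u L y)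
    (N : ℕ) (φ : List ι → Lp ℝ 2 P) (hφ : ∀ w, φ w ∈ past P wt u y) :
    ‖wordSum N fun w => m.mulWord w (φ w)‖ ^ 2 ≤ wordSum N fun w => ‖φ w‖ ^ 2 := by
  induction N generalizing φ with
  | zero => simp [wordSum_zero, mulWord]
  | succ N ih =>
    have hmem : ∀ σ, (wordSum N fun w => m.mulWord w (φ (w ++ [σ]))) ∈ past P wt u y := fun σ =>
      Submodule.sum_mem _ fun w _ => m.mulWord_mem_past _ (hφ _)
    have h1 : (wordSum (N + 1) fun w => m.mulWord w (φ w)) =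
        ∑ σ, m.mul σ (wordSum N fun w => m.mulWord w (φ (w ++ [σ]))) := by
      rw [wordSum_succ_snoc]
      simp only [mulWord_snoc, wordSum, map_sum]
    rw [h1, norm_sum_sq_of_orthogonal _ fun σ σ' hσ => hr.lastSpace_orthogonal hσ _
      (m.mul_mem_lastSpace σ _ (hmem σ)) _ (m.mul_mem_lastSpace σ' _ (hmem σ')),
      wordSum_succ_snoc]
    refine Finset.sum_le_sum fun σ _ => le_trans ?_ (ih (fun w => φ (w ++ [σ])) fun w => hφ _)
    exact pow_le_pow_left₀ (norm_nonneg _) (m.norm_mul_le σ _) 2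

theorem norm_comb_sq_le {E : Type*} [NormedAddCommGroup E] [InnerProductSpace ℝ E] {a b : ℕ}
    (A : Matrix (Fin a) (Fin b) ℝ) (g : Fin b → E) (i : Fin a) :
    ‖comb A g i‖ ^ 2 ≤ (∑ j, ‖g j‖ ^ 2) * ∑ j, A i j ^ 2 := by
  have h1 : ‖comb A g i‖ ≤ ∑ j, ‖g j‖ * |A i j| :=
    (norm_sum_le _ _).trans (Finset.sum_le_sum fun j _ => by
      rw [norm_smul, Real.norm_eq_abs, mul_comm])
  refine (pow_le_pow_left₀ (norm_nonneg _) h1 2).trans ?_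
  refine (Finset.sum_mul_sq_le_sq_mul_sq _ _ _).trans (le_of_eq ?_)
  simp only [sq_abs]

namespace IsPredictorState

variable {m : PastModel P wt u y} {C : Matrix (Fin p) (Fin n) ℝ}
  {A : ι → Matrix (Fin n) (Fin n) ℝ} {B : Fin p × ι → Fin n → ℝ} {f : Fin n → Lp ℝ 2 P}

/-- The state belongs to the past of the innovation. -/
theorem mem_closedSpan_innovation (h : IsPredictorState m C A B f) (hr : IsRC P wt u L y)
    (hS : IsSquareSummable (Psi P wt u y)) {K : ι → Matrix (Fin n) (Fin p) ℝ}
    (hK : ∀ i, f i = ∑ σ, (comb (A σ) (fun j => m.mul σ (f j)) i +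
        comb (K σ) (innovationImage m C f [σ]) i)) (i : Fin n) :
    f i ∈ closedSpan {g | ∃ w : List ι, w ≠ [] ∧ ∃ j, g = innovationImage m C f w j} := by
  set V := closedSpan {g | ∃ w : List ι, w ≠ [] ∧ ∃ j, g = innovationImage m C f w j} with hV
  have hVc : IsClosed (V : Set (Lp ℝ 2 P)) := Submodule.isClosed_topologicalClosure _
  have hmul : ∀ σ, ∀ g ∈ V, m.mul σ g ∈ V := fun σ => map_mem_closedSpan hVc (m.mul σ) (by
    rintro _ ⟨w, hw, j, rfl⟩
    rw [← m.image_snoc _ _ hw σ j]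
    exact subset_closedSpan ⟨_, by simp, j, rfl⟩)
  -- The remainder after substituting the state equation into itself N times; all other terms are
  -- combinations of z^e_w.
  let R : ℕ → Fin n → Lp ℝ 2 P := fun N i =>
    wordSum N fun w => m.mulWord w (comb (wordProd A w) f i)
  have hR : ∀ N i, R (N + 1) i = ∑ σ, comb (A σ) (fun j => m.mul σ (R N j)) i := by
    intro N i
    simp only [R, ← map_comb]
    rw [wordSum_succ_snoc]
    refine Finset.sum_congr rfl fun σ _ => ?_
    simp only [PastModel.mulWord_snoc, wordProd_snoc, ← comb_comb]
    simp only [wordSum, comb, map_sum, map_smul, Finset.smul_sum]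
    rw [Finset.sum_comm]
  have hfR : ∀ N i, f i - R N i ∈ V := by
    intro N
    induction N with
    | zero =>
      intro i
      have : R 0 i = f i := by
        simp [R, wordSum_zero, PastModel.mulWord, wordProd, comb, Matrix.one_apply]
      rw [this, sub_self]
      exact Submodule.zero_mem _
    | succ N ih =>
      intro i
      rw [hR, hK i, ← Finset.sum_sub_distrib]
      refine Submodule.sum_mem _ fun σ _ => ?_
      rw [add_sub_right_comm, ← comb_sub]
      refine Submodule.add_mem _ (comb_mem _ (fun j => ?_) i) (comb_mem _ (fun j => ?_) i)
      · rw [← map_sub]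
        exact hmul σ _ (ih j)
      · exact subset_closedSpan ⟨_, by simp, j, rfl⟩
  have hsum : Tendsto (fun N => (∑ j, ‖f j‖ ^ 2) *
      ∑ j, wordSum N fun w => wordProd A w i j ^ 2) atTop (𝓝 0) := by
    have h1 : Tendsto (fun N => ∑ j, wordSum N fun w => wordProd A w i j ^ 2) atTop
        (𝓝 (∑ _j : Fin n, (0 : ℝ))) := tendsto_finsetSum _ fun j _ =>
      ((summable_words_iff fun w => sq_nonneg _).1 (h.minimal.summable_sq hS i j)).tendsto_atTop_zero
    simpa using h1.const_mul (∑ j, ‖f j‖ ^ 2)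
  have hR0 : Tendsto (fun N => R N i) atTop (𝓝 0) := by
    rw [tendsto_zero_iff_norm_tendsto_zero]
    have h2 : Tendsto (fun N => ‖R N i‖ ^ 2) atTop (𝓝 0) := by
      refine squeeze_zero (fun N => sq_nonneg _) (fun N => ?_) hsum
      refine (m.norm_wordSum_mulWord_sq_le hr N _ fun w => comb_mem _ h.mem i).trans ?_
      rw [← wordSum_sum, ← wordSum_mul_left]
      exact wordSum_mono N fun w => norm_comb_sq_le _ _ i
    simpa [Real.sqrt_sq (norm_nonneg _)] using h2.sqrt
  have hlim : Tendsto (fun N => f i - R N i) atTop (𝓝 (f i)) := by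
    simpa using tendsto_const_nhds.sub hR0
  exact hVc.mem_of_tendsto hlim (Eventually.of_forall fun N => hfR N i)

theorem exists_realization [IsProbabilityMeasure P] (h : IsPredictorState m C A B f)
    (hr : IsRC P wt u L y) (hwt : ∀ σ, 0 < wt σ) (hL : IsAdmissible P u L)
    (hy_meas : ∀ t, Measurable (y t)) (hS : IsSquareSummable (Psi P wt u y)) :
    ∃ G : GBS P u n p p, G.IsForwardInnovationRealization wt L y := by
  obtain ⟨K, hK, hKe⟩ := h.exists_gain hr hL
  have htr := h.isTransform hr
  have he := htr.isRC hwt hr hL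
  have hsqrt : ∀ σ, √(wt σ) * √(wt σ) = wt σ := fun σ => Real.mul_self_sqrt (hwt σ).le
  -- Multiplication by σ carries the factor u_σ/√p_σ, so A_σ and K_σ are divided by √p_σ; this also
  -- absorbs the weights p_σ in the stability condition.
  have hstate : ∀ t, ∀ᵐ ω ∂P, (fun i => m.shift (t + 1) (f i) ω) = ∑ σ, u σ t ω •
      (((1 / √(wt σ)) • A σ) *ᵥ (fun i => m.shift t (f i) ω) +
        ((1 / √(wt σ)) • K σ) *ᵥ innovation P wt u y t ω) := by
    intro t
    have h1 : ∀ i, m.shift (t + 1) (f i) =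
        ∑ σ, (comb (A σ) (fun j => m.shift (t + 1) (m.mul σ (f j))) i +
          comb (K σ) (fun j => m.shift (t + 1) (innovationImage m C f [σ] j)) i) := by
      intro i
      conv_lhs => rw [hK i]
      simp only [map_sum, map_add, map_comb]
    filter_upwards [ae_all_iff.2 fun i => coeFn_sum Finset.univ fun σ =>
        comb (A σ) (fun j => m.shift (t + 1) (m.mul σ (f j))) i +
          comb (K σ) (fun j => m.shift (t + 1) (innovationImage m C f [σ] j)) i,
      ae_all_iff.2 fun i => ae_all_iff.2 fun σ => Lp.coeFn_add
        (comb (A σ) (fun j => m.shift (t + 1) (m.mul σ (f j))) i)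
        (comb (K σ) (fun j => m.shift (t + 1) (innovationImage m C f [σ] j)) i),
      ae_all_iff.2 fun i => ae_all_iff.2 fun σ =>
        coeFn_comb (A σ) (fun j => m.shift (t + 1) (m.mul σ (f j))) i,
      ae_all_iff.2 fun i => ae_all_iff.2 fun σ =>
        coeFn_comb (K σ) (fun j => m.shift (t + 1) (innovationImage m C f [σ] j)) i,
      ae_all_iff.2 fun σ => ae_all_iff.2 fun j => m.coeFn_shift_mul hwt hr σ t _ (h.mem j),
      ae_all_iff.2 fun σ => ae_all_iff.2 fun j =>
        htr.coeFn_image hwt hr (List.cons_ne_nil σ []) (t + 1) j] with ω h2 h3 h4 h5 h6 h7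
    funext i
    rw [h1 i, h2 i, Finset.sum_apply]
    refine Finset.sum_congr rfl fun σ _ => ?_
    rw [h3 i σ, Pi.add_apply, h4 i σ, h5 i σ]
    simp only [h6, h7, zPast_singleton hwt, Pi.smul_apply, Pi.add_apply, smul_eq_mul, mulVec,
      dotProduct, Matrix.smul_apply, inputFactor]
    rw [mul_add, Finset.mul_sum, Finset.mul_sum]
    congr 1 <;> refine Finset.sum_congr rfl fun j _ => ?_ <;> ring
  have hmeas : ∀ t, Measurable (innovation P wt u y t) := by
    intro t
    refine (hy_meas t).sub (measurable_pi_lambda _ fun i => ?_)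
    simp only [projOn]
    split
    · exact (Lp.stronglyMeasurable _).measurable
    · exact measurable_const
  let G : GBS P u n p p :=
    { A := fun σ => (1 / √(wt σ)) • A σ
      K := fun σ => (1 / √(wt σ)) • K σ
      C := C
      D := 1
      x := fun t ω i => m.shift t (f i) ω
      v := innovation P wt u y
      measurable_x := fun t => measurable_pi_lambda _ fun i =>
        (Lp.stronglyMeasurable _).measurable
      measurable_v := hmeas
      state_eq := hstate }
  refine ⟨G, ⟨fun t => ?_, ⟨he, ?_, fun t i => ⟨_, ?_, EventuallyEq.refl _ _⟩, ?_, ?_⟩, rfl,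
    fun t => EventuallyEq.refl _ _⟩⟩
  · filter_upwards [ae_all_iff.2 fun i => h.coeFn_innovation hr t i,
      ae_all_iff.2 fun i => coeFn_comb C (fun j => m.shift t (f j)) i] with ω h1 h2
    funext i
    have h3 := h1 i
    rw [map_comb, h2 i] at h3
    change y t ω i = (C *ᵥ fun j => m.shift t (f j) ω) i +
      ((1 : Matrix (Fin p) (Fin p) ℝ) *ᵥ innovation P wt u y t ω) i
    rw [one_mulVec, h3, add_sub_cancel]
  · exact he.covT_eq_zero_of_covLam_eq_zero fun w hw t => h.covLam_innovation hr hwt hw t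
  · refine map_mem_closedSpan (Submodule.isClosed_topologicalClosure _) (m.shift t) ?_ _
      (h.mem_closedSpan_innovation hr hS hK i)
    rintro _ ⟨w, hw, j, rfl⟩
    exact subset_closedSpan ⟨w, hw, j, htr.coeFn_image hwt hr hw t j⟩
  · have h1 : ∀ σ, wt σ • (((1 / √(wt σ)) • A σ)ᵀ ⊗ₖ ((1 / √(wt σ)) • A σ)ᵀ) =
        (A σ)ᵀ ⊗ₖ (A σ)ᵀ := by
      intro σ
      have : wt σ * (1 / √(wt σ) * (1 / √(wt σ))) = 1 := by
        rw [div_mul_div_comm, hsqrt, one_mul, mul_one_div_cancel (hwt σ).ne']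
      rw [transpose_smul, smul_kronecker, kronecker_smul, smul_smul, smul_smul, mul_assoc, this,
        one_smul]
    change IsStableMatrix (∑ σ, wt σ • (((1 / √(wt σ)) • A σ)ᵀ ⊗ₖ ((1 / √(wt σ)) • A σ)ᵀ))
    simp only [h1]
    exact isStableMatrix_of_summable_sq (h.minimal.summable_sq hS)
  · intro σ₁ σ₂ hσ
    refine ⟨?_, fun t => ?_⟩
    · change ((1 / √(wt σ₂)) • A σ₂) * ((1 / √(wt σ₁)) • A σ₁) = 0
      simp [h.mul_eq_zero hr hL hσ]
    · change ((1 / √(wt σ₂)) • A σ₂) * ((1 / √(wt σ₁)) • K σ₁) *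
        covT P wt u (innovation P wt u y) [σ₁] [σ₁] t = 0
      -- By the normal equations for the gain, K_σ T^e_{σ,σ} = ⟨f, z^e_σ⟩, and z^e_σ lies in the
      -- span of words ending in σ.
      have h1 : A σ₂ * K σ₁ * covT P wt u (innovation P wt u y) [σ₁] [σ₁] t = 0 := by
        rw [Matrix.mul_assoc]
        ext i j
        have h2 : (fun i => (K σ₁ * covT P wt u (innovation P wt u y) [σ₁] [σ₁] t) i j) =
            fun i => ⟪f i, innovationImage m C f [σ₁] j⟫_ℝ := by
          funext i
          rw [← hKe, inner_comb_left, Matrix.mul_apply]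
          simp only [htr.covT_apply hwt hr (List.cons_ne_nil σ₁ []) (List.cons_ne_nil σ₁ [])]
          rfl
        have h3 := congrFun (h.mulVec_inner_eq_zero hr hL hσ
          (h.innovationImage_mem_lastSpace hr σ₁ j)) i
        rw [← h2] at h3
        rw [Matrix.mul_apply]
        exact h3
      simp [h1]

end IsPredictorState

theorem exists_forwardInnovationRealization [IsProbabilityMeasure P] (hwt : ∀ σ, 0 < wt σ)
    (hL : IsAdmissible P u L) (hy_meas : ∀ t, Measurable (y t))
    (hy : ∀ w : List ι, w ≠ [] → ∀ t, SqIntegrable P (zFuture wt u y w t))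
    (hr : IsRC P wt u L y) (hrat : IsRational (Psi P wt u y))
    (hS : IsSquareSummable (Psi P wt u y)) :
    ∃ (n : ℕ) (G : GBS P u n p p), G.IsForwardInnovationRealization wt L y := by
  obtain ⟨m⟩ := hr.nonempty_pastModel hL
  obtain ⟨n, C, A, B, hmin⟩ := hrat.exists_minimal
  obtain ⟨f, hf⟩ := hmin.exists_predictorState hr hwt hy m
  exact ⟨n, hf.exists_realization hr hwt hL hy_meas hS⟩

end Realization

end GBSReal

end

theorem mainTheorem3 {Ω ι : Type*} [MeasurableSpace Ω] (P : Measure Ω) [IsProbabilityMeasure P]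
    [Fintype ι] (wt : ι → ℝ) (hwt : ∀ σ, 0 < wt σ)
    (u : ι → ℤ → Ω → ℝ) (hu_meas : ∀ σ t, Measurable (u σ t))
    (hu : GBSReal.InputAssumption P u)
    (L : Set (List ι)) (hL : GBSReal.IsAdmissible P u L)
    {p : ℕ} (y : ℤ → Ω → (Fin p → ℝ)) (hy_meas : ∀ t, Measurable (y t))
    (hy : ∀ w : List ι, w ≠ [] → ∀ t, GBSReal.SqIntegrable P (GBSReal.zFuture wt u y w t)) :
    ((∃ (n m : ℕ) (B : GBSReal.GBS P u n m p), B.IsRealization y ∧ B.Regular wt L) ↔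
      (GBSReal.IsRC P wt u L y ∧ GBSReal.IsRational (GBSReal.Psi P wt u y) ∧
        GBSReal.IsSquareSummable (GBSReal.Psi P wt u y))) ∧
    ((∃ (n m : ℕ) (B : GBSReal.GBS P u n m p), B.IsRealization y ∧ B.Regular wt L) →
      ∃ (n : ℕ) (B : GBSReal.GBS P u n p p), B.IsForwardInnovationRealization wt L y) := by
  have h1 : (∃ (n m : ℕ) (B : GBSReal.GBS P u n m p), B.IsRealization y ∧ B.Regular wt L) →
      (GBSReal.IsRC P wt u L y ∧ GBSReal.IsRational (GBSReal.Psi P wt u y) ∧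
        GBSReal.IsSquareSummable (GBSReal.Psi P wt u y)) := by
    rintro ⟨n, m, B, hB, hreg⟩
    exact hreg.isRC_and_isRational_and_isSquareSummable hwt hu hL hB
  have h2 : (GBSReal.IsRC P wt u L y ∧ GBSReal.IsRational (GBSReal.Psi P wt u y) ∧
        GBSReal.IsSquareSummable (GBSReal.Psi P wt u y)) →
      ∃ (n : ℕ) (B : GBSReal.GBS P u n p p), B.IsForwardInnovationRealization wt L y :=
    fun ⟨hr, hrat, hS⟩ =>
      GBSReal.exists_forwardInnovationRealization hwt hL hy_meas hy hr hrat hS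
  -- A forward innovation realization is regular, so the same construction settles the converse and
  -- the last claim.
  refine ⟨⟨h1, fun h => ?_⟩, fun h => h2 (h1 h)⟩
  obtain ⟨n, B, hB⟩ := h2 h
  exact ⟨n, p, B, hB.realizes, hB.regular⟩
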